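/- Let $T\subset\mathbb R^2$ be an equilateral triangle of side $1$, and for $n\in\mathbb N=\{0,1,2,\dots\}$ let $\Omega_n$ be the open polygonal domain whose boundary is the $n$-th pre-fractal approximation $K_n$ of the Koch snowflake: $\Omega_0$ is the interior of $T$, and $\Omega_{n+1}$ is obtained from $\Omega_n$ by erecting an outward equilateral triangle over the middle third of each of the $3\cdot 4^n$ sides of $\partial\Omega_n=K_n$ (and taking the interior of the union of the closed polygons). Let $\Omega=\bigcup_n\Omega_n$ be the open domain bounded by the Koch snowflake. For $G\in\{\Omega,\Omega_0,\Omega_1,\dots\}$, $0<s<1$ and $1<p<\infty$, let $W^{s,p}(G)$ be the space of $u\in L^p(G)$ (functions equal a.e. being identified) with $$\iint_{G\times G}\frac{|u(x)-u(y)|^p}{|x-y|^{2+sp}}\,dx\,dy<\infty .$$ On $\partial G$, $u$ is understood as its trace $u(x)=\lim_{r\to0^+}\frac1{|B(x,r)\cap G|}\int_{B(x,r)\cap G}u(y)\,dy$. Let $s,p\in\mathbb R$ satisfy $2<sp<p$. Let $f\in L^1(\Omega)$, let $b\in C(\overline\Omega)$ with $b(x)>0$ for all $x\in\overline\Omega$,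 and for every $n$ let $\delta_n>0$ and let $\varphi_{1,n},\varphi_{2,n}\in W^{s,p}(\Omega)$ with $\varphi_{1,n}\le\varphi_{2,n}$ a.e. in $\Omega$. Put $$\mathcal K^n=\{v\in W^{s,p}(\Omega_n):\varphi_{1,n}\le v\le\varphi_{2,n}\ \text{a.e. in }\Omega_n\},$$ $$J_{p,n}(v)=\frac1p\iint_{\Omega_n\times\Omega_n}\frac{|v(x)-v(y)|^p}{|x-y|^{2+sp}}\,dx\,dy-\int_{\Omega_n}f(x)v(x)\,dx+\frac{\delta_n}{p}\int_{\partial\Omega_n}b(x)|v(x)|^p\,d\ell ,$$ where $d\ell$ is arc length on $\partial\Omega_n$. Then, for every $n$ such that $\mathcal K^n\neq\emptyset$, the problem $\min_{v\in\mathcal K^n}J_{p,n}(v)$ has a unique solution: there is exactly one $u\in\mathcal K^n$ with $J_{p,n}(u)\le J_{p,n}(v)$ for all $v\in\mathcal K^n$. -/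

import Mathlib

open MeasureTheory Set Filter Topology

noncomputable section

namespace KochObstacle

/-- The Euclidean plane `ℝ²`. -/
abbrev Plane : Type := EuclideanSpace ℝ (Fin 2)

/-! ### The pre-fractal domains and the snowflake domain -/

/-- Left endpoint of the middle third of the segment from `e.1` to `e.2`. -/
def thirdLeft (e : Plane × Plane) : Plane := e.1 + (1 / 3 : ℝ) • (e.2 - e.1)

/-- Right endpoint of the middle third of the segment from `e.1` to `e.2`. -/
def thirdRight (e : Plane × Plane) : Plane := e.1 + (2 / 3 : ℝ) • (e.2 - e.1)

/-- Apex of the equilateral triangle erected over the middle third of the segment from `e.1` to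
`e.2`, on the right-hand side of the direction of travel. -/
def apex (e : Plane × Plane) : Plane :=
  midpoint ℝ e.1 e.2 + (√3 / 6) • !₂[(e.2 - e.1) 1, -(e.2 - e.1) 0]

/-- The four segments of the Koch construction that replace a segment. -/
def subdivide (e : Plane × Plane) : List (Plane × Plane) :=
  [(e.1, thirdLeft e), (thirdLeft e, apex e), (apex e, thirdRight e), (thirdRight e, e.2)]

/-- Vertices of the initial equilateral triangle, of side `1`, in counterclockwise order. -/
def vertexA : Plane := !₂[0, 0]
/-- Second vertex of the initial triangle. -/
def vertexB : Plane := !₂[1, 0]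
/-- Third vertex of the initial triangle. -/
def vertexC : Plane := !₂[1 / 2, √3 / 2]

/-- The `3 * 4 ^ n` oriented edges of the `n`-th polygonal approximation of the snowflake
(counterclockwise, so that the outer side is the right-hand side). -/
def kochEdges : ℕ → List (Plane × Plane)
  | 0 => [(vertexA, vertexB), (vertexB, vertexC), (vertexC, vertexA)]
  | n + 1 => (kochEdges n).flatMap subdivide

/-- The closed region enclosed by the `n`-th polygonal approximation: at every step, the closed
triangle erected over the middle third of each edge is added. -/
def kochPolygon : ℕ → Set Plane
  | 0 => convexHull ℝ {vertexA, vertexB, vertexC}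
  | n + 1 => kochPolygon n ∪
      ⋃ e ∈ kochEdges n, convexHull ℝ {thirdLeft e, apex e, thirdRight e}

/-- The `n`-th pre-fractal polygonal domain `Ω_n` (an open set). -/
def prefractalDomain (n : ℕ) : Set Plane := interior (kochPolygon n)

/-- The open domain `Ω` bounded by the Koch snowflake; it is exhausted by the increasing
sequence of the pre-fractal domains. -/
def snowflakeDomain : Set Plane := ⋃ n, prefractalDomain n

/-! ### Fractional Sobolev spaces and traces -/

/-- The Gagliardo integrand `|u(x) - u(y)|^p / |x - y|^(2 + s p)` on the plane. -/
def gagliardoKernel (s p : ℝ) (u : Plane → ℝ) (z : Plane × Plane) : ℝ :=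
  |u z.1 - u z.2| ^ p / ‖z.1 - z.2‖ ^ (2 + s * p)

/-- The fractional Sobolev space `W^{s,p}(G)`: the classes in `L^p(G)` with finite Gagliardo
integral over `G × G`. -/
def fracSobolev (s p : ℝ) (G : Set Plane) :
    Set (Lp ℝ (ENNReal.ofReal p) (volume.restrict G)) :=
  {u | Integrable (gagliardoKernel s p u) ((volume.restrict G).prod (volume.restrict G))}

/-- The trace `γ₀ u (x) = lim_{r → 0⁺} |B(x,r) ∩ G|⁻¹ ∫_{B(x,r) ∩ G} u`. -/
def trace (G : Set Plane) (u : Plane → ℝ) (x : Plane) : ℝ :=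
  limUnder (𝓝[>] (0 : ℝ)) fun r => ⨍ y in Metric.ball x r ∩ G, u y

/-! ### The pre-fractal obstacle problem -/

/-- The functional `J_{p,n}`; arc length on the polygonal curve `∂Ω_n` is the one-dimensional
Hausdorff measure, and `u` is evaluated on `∂Ω_n` through its trace. -/
def energy (s p : ℝ) (n : ℕ) (δ : ℝ) (f b : Plane → ℝ)
    (u : Lp ℝ (ENNReal.ofReal p) (volume.restrict (prefractalDomain n))) : ℝ :=
  1 / p * (∫ z, gagliardoKernel s p u z
      ∂((volume.restrict (prefractalDomain n)).prod (volume.restrict (prefractalDomain n))))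
    - (∫ x in prefractalDomain n, f x * u x)
    + δ / p * ∫ x in frontier (prefractalDomain n),
        b x * |trace (prefractalDomain n) u x| ^ p ∂(Measure.hausdorffMeasure 1)

/-- The admissible set `𝒦^n`: functions in `W^{s,p}(Ω_n)` between the obstacles in `Ω_n`. -/
def admissible (s p : ℝ) (n : ℕ) (φ₁ φ₂ : Plane → ℝ) :
    Set (Lp ℝ (ENNReal.ofReal p) (volume.restrict (prefractalDomain n))) :=
  {v | v ∈ fracSobolev s p (prefractalDomain n) ∧
    ∀ᵐ x ∂(volume.restrict (prefractalDomain n)), φ₁ x ≤ v x ∧ v x ≤ φ₂ x}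

end KochObstacle

end

open KochObstacle

/-! The proof is the direct method, with uniform convergence in place of weak compactness. The
hypotheses force `2 < s * p < p`, so `p > 2`.

Each pre-fractal polygon is a finite union of nondegenerate triangles, so its interior `G` satisfies
`|B(x,r) ∩ G| ≥ c r²` on its closure for bounded `r`, and its frontier has finite length
(`goodRegion_kochPolygon`). By Jensen, averages of `u` over comparable concentric balls differ by at
most a constant times `[u] r^((sp-2)/p)`, where `[u]` is the Gagliardo seminorm. As `sp > 2`, dyadic
summation shows that the trace exists everywhere on the closure and differs from the mean of `u` by
at most a multiple of `[u]` (`MeasureDense.abs_average_sub_trace_le`). The boundary term has a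
weight of positive mass and controls the mean. So the sup norm is bounded by the `p`-th root of the
Gagliardo integral plus the boundary term (`BoundaryWeight.exists_trace_rpow_le`), which makes sense
of `∫ f u` for `f ∈ L¹` and, by Young, gives coercivity.

Clarkson's inequality for `p ≥ 2` bounds the seminorm of a half difference by the convexity gap of
the energy (`BoundaryWeight.obstacleEnergy_midpoint_le`). This gives uniqueness and makes minimizing
sequences uniformly Cauchy. At the limit, Fatou handles the Gagliardo integral, and dominated
convergence the boundary and source terms. -/

namespace KochObstacle

variable {s p c R : ℝ} {G : Set Plane} {u v : Plane → ℝ}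

/-! ### Averages and the Gagliardo integral -/

/-- The Gagliardo integral of `u` over `G × G`. -/
noncomputable def gagliardo (s p : ℝ) (G : Set Plane) (u : Plane → ℝ) : ℝ :=
  ∫ z, gagliardoKernel s p u z ∂((volume.restrict G).prod (volume.restrict G))

/-- Measurable functions on `G`, integrable, with finite Gagliardo integral. -/
structure FiniteGagliardo (s p : ℝ) (G : Set Plane) (u : Plane → ℝ) : Prop where
  integrable : IntegrableOn u G
  kernel : Integrable (gagliardoKernel s p u) ((volume.restrict G).prod (volume.restrict G))

/-- A bounded open set satisfying the measure density condition up to scale `R`. -/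
structure MeasureDense (G : Set Plane) (c R : ℝ) : Prop where
  isOpen : IsOpen G
  c_pos : 0 < c
  R_pos : 0 < R
  subset_ball : ∀ x ∈ closure G, G ⊆ Metric.ball x R
  density : ∀ x ∈ closure G, ∀ r, 0 < r → r ≤ R →
    c * r ^ 2 ≤ volume.real (Metric.ball x r ∩ G)

lemma gagliardoKernel_nonneg (s p : ℝ) (u : Plane → ℝ) (z : Plane × Plane) :
    0 ≤ gagliardoKernel s p u z := by
  unfold gagliardoKernel; positivity

lemma gagliardo_nonneg (s p : ℝ) (G : Set Plane) (u : Plane → ℝ) : 0 ≤ gagliardo s p G u :=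
  integral_nonneg fun _ => gagliardoKernel_nonneg s p u _

/-- The denominator of the kernel is at most `d ^ (2 + s * p)`. On the diagonal both sides vanish.
-/
lemma abs_sub_rpow_le_mul_gagliardoKernel (hp : 0 < p) (hs : 0 < 2 + s * p) {d : ℝ}
    (u : Plane → ℝ) (z : Plane × Plane) (hd : ‖z.1 - z.2‖ ≤ d) :
    |u z.1 - u z.2| ^ p ≤ d ^ (2 + s * p) * gagliardoKernel s p u z := by
  unfold gagliardoKernel
  rcases (norm_nonneg (z.1 - z.2)).eq_or_lt with h | h
  · have : z.1 = z.2 := by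
      rw [← sub_eq_zero, ← norm_eq_zero, ← h]
    simp [this, Real.zero_rpow hp.ne']
  · rw [mul_div_assoc', le_div_iff₀ (by positivity), mul_comm]
    gcongr

/-- Jensen's inequality for `t ↦ t ^ p` on `[0, ∞)`. -/
lemma abs_average_rpow_le {α : Type*} [MeasurableSpace α] {μ : Measure α} [IsFiniteMeasure μ]
    [NeZero μ] {g : α → ℝ} (hp : 1 ≤ p) (hg : Integrable g μ)
    (hgp : Integrable (fun x => |g x| ^ p) μ) :
    |⨍ x, g x ∂μ| ^ p ≤ ⨍ x, |g x| ^ p ∂μ := by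
  have h1 : |⨍ x, g x ∂μ| ≤ ⨍ x, |g x| ∂μ := by
    rw [average_eq, average_eq, smul_eq_mul, smul_eq_mul, abs_mul, abs_of_nonneg (by positivity)]
    gcongr
    exact abs_integral_le_integral_abs
  have h2 := ConvexOn.map_average_le (convexOn_rpow hp)
    (continuousOn_id.rpow_const fun x _ => Or.inr (by linarith)) isClosed_Ici
    (Eventually.of_forall fun x => abs_nonneg (g x)) hg.abs hgp
  exact (Real.rpow_le_rpow (abs_nonneg _) h1 (by linarith)).trans h2

/-- The difference of the two averages is the average of `u y - u z` over `A × B`. Jensen then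
brings in the kernel, whose integral over `A × B` is at most that over `G × G`. -/
lemma abs_average_sub_average_rpow_le (hp : 1 ≤ p) (hs : 0 < 2 + s * p)
    (hu : FiniteGagliardo s p G u) {A B : Set Plane} (hA : A ⊆ G) (hB : B ⊆ G)
    (hA0 : 0 < volume.real A) (hB0 : 0 < volume.real B) {d : ℝ}
    (hAm : MeasurableSet A) (hBm : MeasurableSet B)
    (hd : ∀ y ∈ A, ∀ z ∈ B, ‖y - z‖ ≤ d) :
    |(⨍ y in A, u y) - ⨍ y in B, u y| ^ p ≤
      d ^ (2 + s * p) / (volume.real A * volume.real B) * gagliardo s p G u := by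
  have hAf : volume A ≠ ⊤ := fun h => by simp [measureReal_def, h] at hA0
  have hBf : volume B ≠ ⊤ := fun h => by simp [measureReal_def, h] at hB0
  have : IsFiniteMeasure (volume.restrict A) := ⟨by simpa using hAf.lt_top⟩
  have : IsFiniteMeasure (volume.restrict B) := ⟨by simpa using hBf.lt_top⟩
  have hE : (volume.restrict A).prod (volume.restrict B) ≤
      (volume.restrict G).prod (volume.restrict G) := by
    rw [Measure.prod_restrict, Measure.prod_restrict]
    exact Measure.restrict_mono (prod_mono hA hB) le_rfl
  have hk := hu.kernel.mono_measure hE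
  have hiA : IntegrableOn u A := hu.integrable.mono_set hA
  have hiB : IntegrableOn u B := hu.integrable.mono_set hB
  have hg : Integrable (fun z : Plane × Plane => u z.1 - u z.2)
      ((volume.restrict A).prod (volume.restrict B)) :=
    (hiA.comp_fst _).sub (hiB.comp_snd _)
  have hle : ∀ᵐ z ∂((volume.restrict A).prod (volume.restrict B)),
      |u z.1 - u z.2| ^ p ≤ d ^ (2 + s * p) * gagliardoKernel s p u z := by
    rw [Measure.prod_restrict]
    filter_upwards [ae_restrict_mem (hAm.prod hBm)] with z hz
    exact abs_sub_rpow_le_mul_gagliardoKernel (by linarith) hs u z (hd _ hz.1 _ hz.2)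
  have hgp : Integrable (fun z : Plane × Plane => |u z.1 - u z.2| ^ p)
      ((volume.restrict A).prod (volume.restrict B)) := by
    refine (hk.const_mul (d ^ (2 + s * p))).mono' ?_ ?_
    · exact (hg.aestronglyMeasurable.aemeasurable.abs.pow_const p).aestronglyMeasurable
    · filter_upwards [hle] with z hz
      rwa [Real.norm_of_nonneg (by positivity)]
  have huniv : ((volume.restrict A).prod (volume.restrict B)).real univ =
      volume.real A * volume.real B := by
    rw [Measure.prod_restrict, measureReal_restrict_apply_univ, measureReal_prod_prod]
  have : NeZero ((volume.restrict A).prod (volume.restrict B)) := by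
    refine ⟨fun h => ?_⟩
    rw [h, measureReal_zero_apply] at huniv
    exact (mul_pos hA0 hB0).ne huniv
  have hav : (⨍ z, (u z.1 - u z.2) ∂((volume.restrict A).prod (volume.restrict B))) =
      (⨍ y in A, u y) - ⨍ y in B, u y := by
    rw [average_eq, huniv, integral_sub (hiA.comp_fst _) (hiB.comp_snd _), integral_fun_fst,
      integral_fun_snd, setAverage_eq, setAverage_eq]
    simp only [measureReal_restrict_apply_univ, smul_eq_mul]
    field_simp
  rw [← hav]
  refine (abs_average_rpow_le hp hg hgp).trans ?_
  rw [average_eq, huniv, smul_eq_mul, div_mul_eq_mul_div, inv_mul_eq_div]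
  gcongr
  refine (integral_mono_ae hgp (hk.const_mul _) hle).trans ?_
  rcases isEmpty_or_nonempty A with h | ⟨⟨a, ha⟩⟩
  · simp [isEmpty_coe_sort.1 h] at hA0
  rcases isEmpty_or_nonempty B with h | ⟨⟨b, hb⟩⟩
  · simp [isEmpty_coe_sort.1 h] at hB0
  have hd0 : 0 ≤ d := (norm_nonneg _).trans (hd a ha b hb)
  rw [integral_const_mul]
  gcongr
  exact integral_mono_measure hE (Eventually.of_forall fun _ => gagliardoKernel_nonneg s p u _)
    hu.kernel

/-! ### Traces on measure dense sets -/

/-- Averages over comparable balls differ by a power of the radius. -/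
lemma MeasureDense.abs_average_sub_average_le (hG : MeasureDense G c R) (hp : 1 ≤ p)
    (hs : 0 < 2 + s * p) (hu : FiniteGagliardo s p G u) {x : Plane} (hx : x ∈ closure G)
    {r r' : ℝ} (hr : 0 < r) (hrR : r ≤ R) (hr' : r / 2 ≤ r') (hr'r : r' ≤ r) :
    |(⨍ y in Metric.ball x r ∩ G, u y) - ⨍ y in Metric.ball x r' ∩ G, u y| ≤
      (4 * 2 ^ (2 + s * p) / c ^ 2 * gagliardo s p G u) ^ (1 / p) * r ^ ((s * p - 2) / p) := by
  have hc := hG.c_pos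
  have hp0 : 0 < p := by linarith
  have hr'0 : 0 < r' := by linarith
  have h1 := hG.density x hx r hr hrR
  have h2 := hG.density x hx r' hr'0 (by linarith)
  have key := abs_average_sub_average_rpow_le (A := Metric.ball x r ∩ G)
    (B := Metric.ball x r' ∩ G) (d := 2 * r) hp hs hu inter_subset_right inter_subset_right
    (lt_of_lt_of_le (by positivity) h1) (lt_of_lt_of_le (by positivity) h2)
    (Metric.isOpen_ball.inter hG.isOpen).measurableSet
    (Metric.isOpen_ball.inter hG.isOpen).measurableSet (by
      intro y hy z hz
      have hy := mem_ball_iff_norm.1 hy.1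
      have hz := mem_ball_iff_norm'.1 hz.1
      calc ‖y - z‖ = ‖(y - x) + (x - z)‖ := by simp
        _ ≤ ‖y - x‖ + ‖x - z‖ := norm_add_le _ _
        _ ≤ 2 * r := by linarith)
  have hE := gagliardo_nonneg s p G u
  have h3 : (2 * r) ^ (2 + s * p) / (volume.real (Metric.ball x r ∩ G) *
      volume.real (Metric.ball x r' ∩ G)) * gagliardo s p G u ≤
      (4 * 2 ^ (2 + s * p) / c ^ 2 * gagliardo s p G u) * r ^ (s * p - 2) := by
    have : c ^ 2 * r ^ 4 / 4 ≤ volume.real (Metric.ball x r ∩ G) *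
      volume.real (Metric.ball x r' ∩ G) := by
      calc c ^ 2 * r ^ 4 / 4 = (c * r ^ 2) * (c * (r / 2) ^ 2) := by ring
        _ ≤ (c * r ^ 2) * (c * r' ^ 2) := by gcongr
        _ ≤ _ := by gcongr
    calc _ ≤ (2 * r) ^ (2 + s * p) / (c ^ 2 * r ^ 4 / 4) * gagliardo s p G u := by gcongr
      _ = _ := by
        -- The two areas cost `r ^ 4`; what remains is a positive power of `r` exactly when `s * p >
        -- 2`.
        have h4 : r ^ (2 + s * p) = r ^ (s * p - 2) * r ^ 4 := by
          rw [← Real.rpow_natCast r 4, ← Real.rpow_add hr]; congr 1; push_cast; ring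
        rw [Real.mul_rpow (by norm_num) hr.le, h4]
        field_simp
  have h5 := Real.rpow_le_rpow (by positivity) (key.trans h3) (z := 1 / p) (by positivity)
  rwa [← Real.rpow_mul (abs_nonneg _), mul_one_div_cancel hp0.ne', Real.rpow_one,
    Real.mul_rpow (by positivity) (by positivity), ← Real.rpow_mul hr.le, mul_one_div] at h5

/-- A real function on `(0, R]` whose oscillation on dyadic intervals is controlled by a positive
power of the scale is controlled on all intervals. -/
lemma abs_sub_le_of_dyadic {g : ℝ → ℝ} {M α : ℝ} (hα : 0 < α)
    (h : ∀ r r', 0 < r → r ≤ R → r / 2 ≤ r' → r' ≤ r → |g r - g r'| ≤ M * r ^ α)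
    {r r' : ℝ} (hr' : 0 < r') (hr'r : r' ≤ r) (hrR : r ≤ R) :
    |g r - g r'| ≤ M / (1 - (1 / 2) ^ α) * r ^ α := by
  have hq : ((1 : ℝ) / 2) ^ α < 1 := Real.rpow_lt_one (by norm_num) (by norm_num) hα
  -- Induction on the number of halvings from `r` to `r'`. The constant `K = M / (1 - 2^(-α))` sums
  -- the geometric series, and solves `K = M + K * 2^(-α)`.
  have key : ∀ k : ℕ, ∀ r r', 0 < r' → r' ≤ r → r ≤ R → r / 2 ^ k ≤ r' →
      |g r - g r'| ≤ M / (1 - (1 / 2) ^ α) * r ^ α := by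
    intro k
    induction k with
    | zero =>
      intro r r' h0 h1 h2 h3
      have h4 : r' = r := le_antisymm h1 (by simpa using h3)
      have := (abs_nonneg _).trans (h r r (by linarith) h2 (by linarith) le_rfl)
      rw [h4, sub_self, abs_zero, div_mul_eq_mul_div]
      exact div_nonneg this (by linarith)
    | succ k ih =>
      intro r r' h0 h1 h2 h3
      have hr : 0 < r := by linarith
      have hM : M / (1 - (1 / 2) ^ α) * r ^ α =
          M * r ^ α + M / (1 - (1 / 2) ^ α) * (r / 2) ^ α := by
        have : (r / 2) ^ α = r ^ α * (1 / 2) ^ α := by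
          rw [← Real.mul_rpow hr.le (by norm_num)]; congr 1; ring
        have h5 : (1 - (1 / 2 : ℝ) ^ α) ≠ 0 := by linarith
        rw [this]; field_simp; ring
      have hMn := (abs_nonneg _).trans (h (r/2) (r/2) (by linarith) (by linarith) (by linarith)
        le_rfl)
      by_cases h6 : r / 2 ≤ r'
      · have := h r r' hr h2 h6 h1
        have h7 : 0 ≤ M / (1 - (1 / 2) ^ α) * (r / 2) ^ α := by
          rw [div_mul_eq_mul_div]; exact div_nonneg hMn (by linarith)
        linarith
      · have h7 := h r (r / 2) hr h2 le_rfl (by linarith)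
        have h8 := ih (r / 2) r' h0 (by linarith) (by linarith) (by
          rw [div_div, ← pow_succ']; exact h3)
        rw [hM]
        exact (abs_sub_le _ (g (r / 2)) _).trans (add_le_add h7 h8)
  have hr : 0 < r := by linarith
  obtain ⟨k, hk⟩ := pow_unbounded_of_one_lt (r / r') (one_lt_two (α := ℝ))
  refine key k r r' hr' hr'r hrR ?_
  rw [div_lt_iff₀ hr'] at hk
  rw [div_le_iff₀ (by positivity)]
  linarith

/-- The constant of the oscillation estimate. -/
noncomputable def oscConst (s p c R : ℝ) : ℝ :=
  (4 * 2 ^ (2 + s * p) / c ^ 2) ^ (1 / p) / (1 - (1 / 2) ^ ((s * p - 2) / p)) *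
    R ^ ((s * p - 2) / p)

lemma oscConst_nonneg (hp : 1 ≤ p) (hsp : 2 < s * p) (hR : 0 < R) : 0 ≤ oscConst s p c R := by
  have : ((1 : ℝ) / 2) ^ ((s * p - 2) / p) < 1 :=
    Real.rpow_lt_one (by norm_num) (by norm_num) (div_pos (by linarith) (by linarith))
  unfold oscConst
  have : 0 ≤ 1 - ((1 : ℝ) / 2) ^ ((s * p - 2) / p) := by linarith
  positivity

lemma MeasureDense.abs_average_sub_average_le' (hG : MeasureDense G c R) (hp : 1 ≤ p)
    (hsp : 2 < s * p) (hu : FiniteGagliardo s p G u) {x : Plane} (hx : x ∈ closure G)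
    {r r' : ℝ} (hr' : 0 < r') (hr'r : r' ≤ r) (hrR : r ≤ R) :
    |(⨍ y in Metric.ball x r ∩ G, u y) - ⨍ y in Metric.ball x r' ∩ G, u y| ≤
      (4 * 2 ^ (2 + s * p) / c ^ 2 * gagliardo s p G u) ^ (1 / p) /
        (1 - (1 / 2) ^ ((s * p - 2) / p)) * r ^ ((s * p - 2) / p) :=
  abs_sub_le_of_dyadic (g := fun r => ⨍ y in Metric.ball x r ∩ G, u y)
    (div_pos (by linarith) (by linarith))
    (fun _ _ h1 h2 h3 h4 => hG.abs_average_sub_average_le hp (by linarith) hu hx h1 h2 h3 h4)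
    hr' hr'r hrR

/-- The oscillation bound tends to zero with the radius, so the averages are Cauchy and the
`limUnder` in `trace` is a genuine limit, on the frontier too. -/
lemma MeasureDense.tendsto_trace (hG : MeasureDense G c R) (hp : 1 ≤ p)
    (hsp : 2 < s * p) (hu : FiniteGagliardo s p G u) {x : Plane} (hx : x ∈ closure G) :
    Tendsto (fun r => ⨍ y in Metric.ball x r ∩ G, u y) (𝓝[>] 0) (𝓝 (trace G u x)) := by
  refine tendsto_nhds_limUnder (cauchy_map_iff_exists_tendsto.1 ?_)
  have hα : 0 < (s * p - 2) / p := div_pos (by linarith) (by linarith)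
  set K := (4 * 2 ^ (2 + s * p) / c ^ 2 * gagliardo s p G u) ^ (1 / p) /
        (1 - (1 / 2) ^ ((s * p - 2) / p)) with hK
  have hlim : Tendsto (fun r : ℝ => K * r ^ ((s * p - 2) / p)) (𝓝[>] 0) (𝓝 0) := by
    have h1 : Tendsto (fun r : ℝ => K * r ^ ((s * p - 2) / p)) (𝓝 0)
        (𝓝 (K * 0 ^ ((s * p - 2) / p))) :=
      ((Real.continuousAt_rpow_const _ _ (Or.inr hα.le)).tendsto).const_mul K
    rw [Real.zero_rpow hα.ne', mul_zero] at h1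
    exact h1.mono_left nhdsWithin_le_nhds
  rw [Metric.cauchy_iff]
  refine ⟨inferInstance, fun ε hε => ?_⟩
  have hR := hG.R_pos
  obtain ⟨r, ⟨hr1, hr2⟩, hr3⟩ := ((hlim.eventually (gt_mem_nhds (half_pos hε))).and
    (Ioc_mem_nhdsGT hR)).exists.imp fun r h => (⟨⟨h.1, h.2.2⟩, h.2.1⟩ : (_ ∧ _) ∧ _)
  refine ⟨_, image_mem_map (Ioc_mem_nhdsGT hr3), ?_⟩
  rintro _ ⟨a, ha, rfl⟩ _ ⟨b, hb, rfl⟩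
  have h1 := hG.abs_average_sub_average_le' hp hsp hu hx ha.1 ha.2 hr2
  have h2 := hG.abs_average_sub_average_le' hp hsp hu hx hb.1 hb.2 hr2
  rw [← hK] at h1 h2
  rw [Real.dist_eq]
  rw [abs_sub_comm] at h1
  refine (abs_sub_le _ (⨍ y in Metric.ball x r ∩ G, u y) _).trans_lt ?_
  linarith

/-- The trace differs from the mean value by at most a multiple of the Gagliardo seminorm. -/
lemma MeasureDense.abs_average_sub_trace_le (hG : MeasureDense G c R) (hp : 1 ≤ p)
    (hsp : 2 < s * p) (hu : FiniteGagliardo s p G u) {x : Plane} (hx : x ∈ closure G) :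
    |(⨍ y in G, u y) - trace G u x| ≤ oscConst s p c R * gagliardo s p G u ^ (1 / p) := by
  have h := (tendsto_const_nhds (x := ⨍ y in G, u y)).sub (hG.tendsto_trace hp hsp hu hx) |>.abs
  refine le_of_tendsto h ?_
  filter_upwards [Ioc_mem_nhdsGT hG.R_pos] with r hr
  have h1 := hG.abs_average_sub_average_le' hp hsp hu hx hr.1 hr.2 le_rfl
  -- The ball of radius `R` contains `G`, so the outer average is the mean over `G`.
  rw [inter_eq_right.2 (hG.subset_ball x hx), Real.mul_rpow
    (by have := hG.c_pos; positivity) (gagliardo_nonneg s p G u)] at h1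
  refine h1.trans (le_of_eq ?_)
  unfold oscConst
  ring

lemma MeasureDense.volume_ne_top (hG : MeasureDense G c R) : volume G ≠ ⊤ := by
  rcases G.eq_empty_or_nonempty with rfl | ⟨x, hx⟩
  · simp
  · exact ((measure_mono (hG.subset_ball x (subset_closure hx))).trans_lt
      measure_ball_lt_top).ne

/-- On the domain itself the trace is the function. -/
lemma MeasureDense.trace_ae_eq (hG : MeasureDense G c R) (hp : 1 ≤ p)
    (hsp : 2 < s * p) (hu : FiniteGagliardo s p G u) :
    ∀ᵐ x ∂(volume.restrict G), trace G u x = u x := by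
  have hGm := hG.isOpen.measurableSet
  have hint : Integrable (G.indicator u) volume := hu.integrable.integrable_indicator hGm
  -- Lebesgue differentiation, for the extension of `u` by zero and closed balls; spheres are null,
  -- so open balls give the same averages.
  have h := IsUnifLocDoublingMeasure.ae_tendsto_average (volume : Measure Plane)
    hint.locallyIntegrable 1
  filter_upwards [ae_restrict_of_ae h, ae_restrict_mem hGm] with x hx hxG
  have h1 := hx (fun _ : ℝ => x) (fun r => r) (l := 𝓝[>] 0) tendsto_id (by
    filter_upwards [self_mem_nhdsWithin] with r hr
    exact Metric.mem_closedBall_self (by rw [one_mul]; exact le_of_lt hr))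
  rw [indicator_of_mem hxG] at h1
  refine tendsto_nhds_unique (hG.tendsto_trace hp hsp hu (subset_closure hxG)) (h1.congr' ?_)
  obtain ⟨ρ, hρ, hb⟩ := Metric.isOpen_iff.1 hG.isOpen x hxG
  filter_upwards [Ioo_mem_nhdsGT hρ] with r hr
  have h2 : Metric.ball x r ⊆ G := (Metric.ball_subset_ball hr.2.le).trans hb
  have h3 : (Metric.ball x r : Set Plane) =ᵐ[volume] Metric.closedBall x r := by
    rw [← Metric.ball_union_sphere]
    exact (union_ae_eq_left_iff_ae_subset.2 (ae_le_set.2 (measure_mono_null sdiff_subset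
      (Measure.addHaar_sphere volume x r)))).symm
  rw [inter_eq_left.2 h2, ← setAverage_congr h3]
  exact setAverage_congr_fun Metric.isOpen_ball.measurableSet
    (Eventually.of_forall fun y hy => indicator_of_mem (h2 hy) u)

lemma trace_congr (h : u =ᵐ[volume.restrict G] v) : trace G u = trace G v := by
  funext x
  unfold trace
  congr 1
  funext r
  exact average_congr (ae_mono (Measure.restrict_mono inter_subset_right le_rfl) h)

lemma trace_eq_of_tendsto {x : Plane} {l : ℝ}
    (h : Tendsto (fun r => ⨍ y in Metric.ball x r ∩ G, u y) (𝓝[>] 0) (𝓝 l)) :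
    trace G u x = l := h.limUnder_eq

/-- The center enters only through the indicator of a measurable subset of the product, so Fubini
applies once `u` is replaced by a measurable representative, which changes no average. -/
lemma measurable_average_ball_inter (hG : MeasurableSet G)
    (hu : AEStronglyMeasurable u (volume.restrict G)) (r : ℝ) :
    Measurable fun x => ⨍ y in Metric.ball x r ∩ G, u y := by
  have hcongr : (fun x => ⨍ y in Metric.ball x r ∩ G, u y) =
      fun x => ⨍ y in Metric.ball x r ∩ G, hu.mk u y := by
    funext x
    exact average_congr (ae_mono (Measure.restrict_mono inter_subset_right le_rfl) hu.ae_eq_mk)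
  have hball : MeasurableSet {z : Plane × Plane | z.2 ∈ Metric.ball z.1 r ∩ G} := by
    have h1 : MeasurableSet {z : Plane × Plane | dist z.2 z.1 < r} :=
      measurableSet_lt (measurable_snd.dist measurable_fst) measurable_const
    exact h1.inter (measurable_snd hG)
  have key : ∀ g : Plane → ℝ, StronglyMeasurable g →
      Measurable fun x => ∫ y in Metric.ball x r ∩ G, g y := by
    intro g hg
    have h2 : StronglyMeasurable (Function.uncurry fun x y : Plane =>
        (Metric.ball x r ∩ G).indicator g y) := by
      have : (Function.uncurry fun x y : Plane => (Metric.ball x r ∩ G).indicator g y) =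
          {z : Plane × Plane | z.2 ∈ Metric.ball z.1 r ∩ G}.indicator fun z => g z.2 := by
        funext z
        by_cases hz : z.2 ∈ Metric.ball z.1 r ∩ G <;> simp_all [Function.uncurry, indicator]
      rw [this]
      exact (hg.comp_measurable measurable_snd).indicator hball
    have h3 :=
      (StronglyMeasurable.integral_prod_right (ν := (volume : Measure Plane)) h2).measurable
    convert h3 using 2 with x
    exact (integral_indicator (Metric.isOpen_ball.measurableSet.inter hG)).symm
  rw [hcongr]
  simp_rw [setAverage_eq]
  have h1 : Measurable fun x => volume.real (Metric.ball x r ∩ G) := by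
    simpa using key (fun _ => 1) stronglyMeasurable_const
  exact h1.inv.smul (key _ hu.stronglyMeasurable_mk)

/-- The trace is an everywhere limit of measurable averages on the closure, so `ν` may be singular,
as arc length is. -/
lemma MeasureDense.aestronglyMeasurable_trace (hG : MeasureDense G c R) (hp : 1 ≤ p)
    (hsp : 2 < s * p) (hu : FiniteGagliardo s p G u) {ν : Measure Plane}
    (hν : ∀ᵐ x ∂ν, x ∈ closure G) : AEStronglyMeasurable (trace G u) ν := by
  refine aestronglyMeasurable_of_tendsto_ae (𝓝[>] (0 : ℝ))
    (f := fun r x => ⨍ y in Metric.ball x r ∩ G, u y) (fun r =>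
      (measurable_average_ball_inter hG.isOpen.measurableSet
        hu.integrable.aestronglyMeasurable r).aestronglyMeasurable) ?_
  filter_upwards [hν] with x hx using hG.tendsto_trace hp hsp hu hx

lemma MeasureDense.trace_linear (hG : MeasureDense G c R) (hp : 1 ≤ p)
    (hsp : 2 < s * p) (hu : FiniteGagliardo s p G u) (hv : FiniteGagliardo s p G v) (a b : ℝ)
    {x : Plane} (hx : x ∈ closure G) :
    trace G (fun y => a * u y + b * v y) x = a * trace G u x + b * trace G v x := by
  refine trace_eq_of_tendsto ((((hG.tendsto_trace hp hsp hu hx).const_mul a).add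
    ((hG.tendsto_trace hp hsp hv hx).const_mul b)).congr fun r => ?_)
  have h1 : IntegrableOn u (Metric.ball x r ∩ G) := hu.integrable.mono_set inter_subset_right
  have h2 : IntegrableOn v (Metric.ball x r ∩ G) := hv.integrable.mono_set inter_subset_right
  rw [setAverage_eq, setAverage_eq, setAverage_eq,
    integral_add (h1.const_mul a) (h2.const_mul b), integral_const_mul, integral_const_mul]
  simp only [smul_eq_mul]
  ring

/-! ### Elementary inequalities -/

lemma add_rpow_le_two_rpow_mul {a b : ℝ} (hp : 0 ≤ p) (ha : 0 ≤ a) (hb : 0 ≤ b) :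
    (a + b) ^ p ≤ 2 ^ p * (a ^ p + b ^ p) := by
  have h : (a + b) ^ p ≤ 2 ^ p * max a b ^ p := by
    rw [← Real.mul_rpow (by norm_num) (le_max_of_le_left ha)]
    refine Real.rpow_le_rpow (by positivity) ?_ hp
    linarith [le_max_left a b, le_max_right a b]
  refine h.trans (mul_le_mul_of_nonneg_left ?_ (by positivity))
  rcases max_choice a b with h | h <;> rw [h]
  · exact le_add_of_nonneg_right (by positivity)
  · exact le_add_of_nonneg_left (by positivity)

/-- Clarkson's inequality for real numbers. -/
lemma clarkson_rpow (hp : 2 ≤ p) (a b : ℝ) :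
    |1 / 2 * a + 1 / 2 * b| ^ p + |1 / 2 * a + -(1 / 2) * b| ^ p ≤
      1 / 2 * |a| ^ p + 1 / 2 * |b| ^ p := by
  have hsq : ∀ t : ℝ, |t| ^ p = (t ^ 2) ^ (p / 2) := by
    intro t
    rw [← sq_abs, ← Real.rpow_natCast, ← Real.rpow_mul (abs_nonneg t)]
    congr 1; push_cast; ring
  simp only [hsq]
  -- Superadditivity of `t ^ (p / 2)`; the parallelogram law then turns the sum of squares into the
  -- mean of `a ^ 2` and `b ^ 2`, and convexity of the same power concludes.
  refine (Real.add_rpow_le_rpow_add (sq_nonneg _) (sq_nonneg _) (by linarith)).trans ?_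
  have h := (convexOn_rpow (p := p / 2) (by linarith)).2 (mem_Ici.2 (sq_nonneg a))
    (mem_Ici.2 (sq_nonneg b)) (by norm_num : (0 : ℝ) ≤ 1 / 2) (by norm_num : (0 : ℝ) ≤ 1 / 2)
    (by norm_num)
  simp only [smul_eq_mul] at h
  convert h using 2
  ring

/-- A form of Fatou's lemma for Bochner integrals. -/
lemma integrable_and_integral_le_of_tendsto {α : Type*} [MeasurableSpace α] {μ : Measure α}
    {g : ℕ → α → ℝ} {g₀ : α → ℝ} {a : ℕ → ℝ} {l : ℝ} (hg : ∀ k, Integrable (g k) μ)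
    (hg0 : ∀ k x, 0 ≤ g k x) (hlim : ∀ᵐ x ∂μ, Tendsto (fun k => g k x) atTop (𝓝 (g₀ x)))
    (hle : ∀ k, ∫ x, g k x ∂μ ≤ a k) (ha : Tendsto a atTop (𝓝 l)) :
    Integrable g₀ μ ∧ ∫ x, g₀ x ∂μ ≤ l := by
  have hm : AEStronglyMeasurable g₀ μ :=
    aestronglyMeasurable_of_tendsto_ae atTop (fun k => (hg k).aestronglyMeasurable) hlim
  have h0 : 0 ≤ᵐ[μ] g₀ := by
    filter_upwards [hlim] with x hx using ge_of_tendsto' hx fun k => hg0 k x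
  have hl : 0 ≤ l := ge_of_tendsto' ha fun k => (integral_nonneg (hg0 k)).trans (hle k)
  have key : ∫⁻ x, ENNReal.ofReal (g₀ x) ∂μ ≤ ENNReal.ofReal l := by
    calc ∫⁻ x, ENNReal.ofReal (g₀ x) ∂μ
        = ∫⁻ x, liminf (fun k => ENNReal.ofReal (g k x)) atTop ∂μ := by
          refine lintegral_congr_ae ?_
          filter_upwards [hlim] with x hx
          exact ((ENNReal.continuous_ofReal.tendsto _).comp hx).liminf_eq.symm
      _ ≤ liminf (fun k => ∫⁻ x, ENNReal.ofReal (g k x) ∂μ) atTop :=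
          lintegral_liminf_le' fun k => (hg k).aestronglyMeasurable.aemeasurable.ennreal_ofReal
      _ ≤ liminf (fun k => ENNReal.ofReal (a k)) atTop := by
          refine liminf_le_liminf (Eventually.of_forall fun k => ?_)
          rw [← ofReal_integral_eq_lintegral_ofReal (hg k) (Eventually.of_forall (hg0 k))]
          exact ENNReal.ofReal_le_ofReal (hle k)
      _ = ENNReal.ofReal l := ((ENNReal.continuous_ofReal.tendsto _).comp ha).liminf_eq
  refine ⟨⟨hm, ?_⟩, ?_⟩
  · rw [hasFiniteIntegral_iff_ofReal h0]
    exact key.trans_lt ENNReal.ofReal_lt_top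
  · rw [integral_eq_lintegral_of_nonneg_ae h0 hm]
    exact ENNReal.toReal_le_of_le_ofReal hl key

/-! ### The space of functions with finite Gagliardo integral -/

lemma aestronglyMeasurable_gagliardoKernel (hu : AEStronglyMeasurable u (volume.restrict G)) :
    AEStronglyMeasurable (gagliardoKernel s p u)
      ((volume.restrict G).prod (volume.restrict G)) := by
  have h1 := (hu.comp_fst (ν := volume.restrict G)).sub (hu.comp_snd (μ := volume.restrict G))
  have h2 : Measurable fun z : Plane × Plane => ‖z.1 - z.2‖ ^ (2 + s * p) :=
    ((measurable_fst.sub measurable_snd).norm).pow_const _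
  exact ((h1.aemeasurable.abs.pow_const p).div h2.aemeasurable).aestronglyMeasurable

lemma gagliardoKernel_ae_congr (h : u =ᵐ[volume.restrict G] v) :
    gagliardoKernel s p u =ᵐ[(volume.restrict G).prod (volume.restrict G)]
      gagliardoKernel s p v := by
  filter_upwards [Measure.quasiMeasurePreserving_fst.ae h,
    Measure.quasiMeasurePreserving_snd.ae h] with z h1 h2
  simp only [gagliardoKernel, h1, h2]

lemma FiniteGagliardo.congr (hu : FiniteGagliardo s p G u) (h : u =ᵐ[volume.restrict G] v) :
    FiniteGagliardo s p G v :=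
  ⟨hu.integrable.congr h, hu.kernel.congr (gagliardoKernel_ae_congr h)⟩

lemma FiniteGagliardo.linear (hp : 0 ≤ p) (hu : FiniteGagliardo s p G u)
    (hv : FiniteGagliardo s p G v) (a b : ℝ) :
    FiniteGagliardo s p G fun y => a * u y + b * v y := by
  have hint : IntegrableOn (fun y => a * u y + b * v y) G :=
    (hu.integrable.const_mul a).add (hv.integrable.const_mul b)
  refine ⟨hint, ((hu.kernel.const_mul (2 ^ p * |a| ^ p)).add
    (hv.kernel.const_mul (2 ^ p * |b| ^ p))).mono'
    (aestronglyMeasurable_gagliardoKernel hint.aestronglyMeasurable)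
    (Eventually.of_forall fun z => ?_)⟩
  rw [Real.norm_of_nonneg (gagliardoKernel_nonneg s p _ _)]
  simp only [gagliardoKernel, Pi.add_apply]
  rw [mul_div_assoc', mul_div_assoc', ← add_div]
  gcongr
  calc |a * u z.1 + b * v z.1 - (a * u z.2 + b * v z.2)| ^ p
      = |a * (u z.1 - u z.2) + b * (v z.1 - v z.2)| ^ p := by congr 2; ring
    _ ≤ (|a| * |u z.1 - u z.2| + |b| * |v z.1 - v z.2|) ^ p := by
        rw [← abs_mul, ← abs_mul]
        exact Real.rpow_le_rpow (abs_nonneg _) (abs_add_le _ _) hp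
    _ ≤ 2 ^ p * ((|a| * |u z.1 - u z.2|) ^ p + (|b| * |v z.1 - v z.2|) ^ p) :=
        add_rpow_le_two_rpow_mul hp (by positivity) (by positivity)
    _ = _ := by
        rw [Real.mul_rpow (abs_nonneg _) (abs_nonneg _),
          Real.mul_rpow (abs_nonneg _) (abs_nonneg _)]
        ring

lemma gagliardo_clarkson (hp : 2 ≤ p) (hu : FiniteGagliardo s p G u)
    (hv : FiniteGagliardo s p G v) :
    gagliardo s p G (fun y => 1 / 2 * u y + 1 / 2 * v y) +
      gagliardo s p G (fun y => 1 / 2 * u y + -(1 / 2) * v y) ≤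
      1 / 2 * gagliardo s p G u + 1 / 2 * gagliardo s p G v := by
  unfold gagliardo
  rw [← integral_const_mul, ← integral_const_mul,
    ← integral_add (hu.linear (by linarith) hv _ _).kernel (hu.linear (by linarith) hv _ _).kernel,
    ← integral_add (hu.kernel.const_mul _) (hv.kernel.const_mul _)]
  refine integral_mono ((hu.linear (by linarith) hv _ _).kernel.add
    (hu.linear (by linarith) hv _ _).kernel)
    ((hu.kernel.const_mul _).add (hv.kernel.const_mul _)) fun z => ?_
  simp only [gagliardoKernel]
  rw [mul_div_assoc', mul_div_assoc', ← add_div, ← add_div]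
  refine div_le_div_of_nonneg_right ?_ (by positivity)
  refine le_trans (le_of_eq ?_) (clarkson_rpow hp (u z.1 - u z.2) (v z.1 - v z.2))
  congr 1 <;> congr 2 <;> ring

/-! ### The boundary term -/

/-- The weighted boundary integral of the trace. -/
noncomputable def boundaryTerm (p : ℝ) (G : Set Plane) (ν : Measure Plane) (w u : Plane → ℝ) : ℝ :=
  ∫ x, w x * |trace G u x| ^ p ∂ν

/-- The sum of the Gagliardo integral and the boundary term. -/
noncomputable def fullSeminorm (s p : ℝ) (G : Set Plane) (ν : Measure Plane) (w u : Plane → ℝ) :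
    ℝ :=
  gagliardo s p G u + boundaryTerm p G ν w u

/-- An integrable nonnegative weight of positive mass on the closure of `G`. -/
structure BoundaryWeight (G : Set Plane) (ν : Measure Plane) (w : Plane → ℝ) : Prop where
  mem_closure : ∀ᵐ x ∂ν, x ∈ closure G
  integrable : Integrable w ν
  nonneg : ∀ᵐ x ∂ν, 0 ≤ w x
  integral_pos : 0 < ∫ x, w x ∂ν

variable {ν : Measure Plane} {w : Plane → ℝ}

lemma BoundaryWeight.boundaryTerm_nonneg (hw : BoundaryWeight G ν w) (u : Plane → ℝ) :
    0 ≤ boundaryTerm p G ν w u := by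
  refine integral_nonneg_of_ae ?_
  filter_upwards [hw.nonneg] with x hx
  positivity

lemma BoundaryWeight.fullSeminorm_nonneg (hw : BoundaryWeight G ν w) (u : Plane → ℝ) :
    0 ≤ fullSeminorm s p G ν w u :=
  add_nonneg (gagliardo_nonneg s p G u) (hw.boundaryTerm_nonneg u)

lemma BoundaryWeight.gagliardo_le (hw : BoundaryWeight G ν w) (u : Plane → ℝ) :
    gagliardo s p G u ≤ fullSeminorm s p G ν w u :=
  le_add_of_nonneg_right (hw.boundaryTerm_nonneg u)

/-- The trace is bounded on the closure, by the mean plus the oscillation bound. -/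
lemma BoundaryWeight.integrable_mul_trace (hw : BoundaryWeight G ν w) (hG : MeasureDense G c R)
    (hp : 1 ≤ p) (hsp : 2 < s * p) (hu : FiniteGagliardo s p G u) :
    Integrable (fun x => w x * |trace G u x| ^ p) ν := by
  have hm := hG.aestronglyMeasurable_trace hp hsp hu hw.mem_closure
  set M := |⨍ y in G, u y| + oscConst s p c R * gagliardo s p G u ^ (1 / p)
  refine (hw.integrable.mul_const (M ^ p)).mono'
    (hw.integrable.aestronglyMeasurable.mul
      (hm.aemeasurable.abs.pow_const p).aestronglyMeasurable) ?_
  filter_upwards [hw.mem_closure, hw.nonneg] with x hx hwx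
  rw [Real.norm_of_nonneg (by positivity)]
  gcongr
  have := hG.abs_average_sub_trace_le hp hsp hu hx
  rw [abs_sub_comm] at this
  have h2 := abs_sub_abs_le_abs_sub (trace G u x) (⨍ y in G, u y)
  change _ ≤ _ + _
  linarith

lemma BoundaryWeight.boundaryTerm_clarkson (hw : BoundaryWeight G ν w) (hG : MeasureDense G c R)
    (hp : 2 ≤ p) (hsp : 2 < s * p) (hu : FiniteGagliardo s p G u)
    (hv : FiniteGagliardo s p G v) :
    boundaryTerm p G ν w (fun y => 1 / 2 * u y + 1 / 2 * v y) +
      boundaryTerm p G ν w (fun y => 1 / 2 * u y + -(1 / 2) * v y) ≤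
      1 / 2 * boundaryTerm p G ν w u + 1 / 2 * boundaryTerm p G ν w v := by
  have hp1 : 1 ≤ p := by linarith
  have hi := fun a b => hw.integrable_mul_trace hG hp1 hsp (hu.linear (by linarith) hv a b)
  have hiu := hw.integrable_mul_trace hG hp1 hsp hu
  have hiv := hw.integrable_mul_trace hG hp1 hsp hv
  unfold boundaryTerm
  rw [← integral_const_mul, ← integral_const_mul, ← integral_add (hi _ _) (hi _ _),
    ← integral_add (hiu.const_mul _) (hiv.const_mul _)]
  refine integral_mono_ae ((hi _ _).add (hi _ _)) ((hiu.const_mul _).add (hiv.const_mul _)) ?_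
  filter_upwards [hw.mem_closure, hw.nonneg] with x hx hwx
  simp only [hG.trace_linear hp1 hsp hu hv _ _ hx]
  have := mul_le_mul_of_nonneg_left (clarkson_rpow hp (trace G u x) (trace G v x)) hwx
  linarith

lemma BoundaryWeight.fullSeminorm_clarkson (hw : BoundaryWeight G ν w) (hG : MeasureDense G c R)
    (hp : 2 ≤ p) (hsp : 2 < s * p) (hu : FiniteGagliardo s p G u)
    (hv : FiniteGagliardo s p G v) :
    fullSeminorm s p G ν w (fun y => 1 / 2 * u y + 1 / 2 * v y) +
      fullSeminorm s p G ν w (fun y => 1 / 2 * u y + -(1 / 2) * v y) ≤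
      1 / 2 * fullSeminorm s p G ν w u + 1 / 2 * fullSeminorm s p G ν w v := by
  have h1 := gagliardo_clarkson hp hu hv
  have h2 := hw.boundaryTerm_clarkson hG hp hsp hu hv
  unfold fullSeminorm
  linarith

/-- Morrey's inequality in the form used here: traces are bounded by the full seminorm. -/
lemma BoundaryWeight.exists_trace_rpow_le (hw : BoundaryWeight G ν w) (hG : MeasureDense G c R)
    (hp : 1 ≤ p) (hsp : 2 < s * p) :
    ∃ C, 0 ≤ C ∧ ∀ u, FiniteGagliardo s p G u → ∀ x ∈ closure G,
      |trace G u x| ^ p ≤ C * fullSeminorm s p G ν w u := by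
  set W := ∫ x, w x ∂ν
  have hW : 0 < W := hw.integral_pos
  have hp0 : 0 < p := by linarith
  have hD : 0 ≤ oscConst s p c R := oscConst_nonneg hp hsp hG.R_pos
  set D := oscConst s p c R
  set K : ℝ := 2 ^ p
  have hK : 0 ≤ K := by positivity
  refine ⟨K * (K * (1 / W + D ^ p) + D ^ p), by positivity, fun u hu x hx => ?_⟩
  set m := ⨍ y in G, u y
  have hE := gagliardo_nonneg s p G u
  set E := gagliardo s p G u with hEdef
  have hB := hw.boundaryTerm_nonneg (p := p) u
  set B := boundaryTerm p G ν w u with hBdef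
  have hosc : ∀ y ∈ closure G, |m - trace G u y| ≤ D * E ^ (1 / p) := fun y hy =>
    hG.abs_average_sub_trace_le hp hsp hu hy
  have he : (D * E ^ (1 / p)) ^ p = D ^ p * E := by
    rw [Real.mul_rpow hD (by positivity), ← Real.rpow_mul hE, one_div_mul_cancel hp0.ne',
      Real.rpow_one]
  have comparison : ∀ a b : ℝ, |a - b| ≤ D * E ^ (1 / p) → |a| ^ p ≤ K * (|b| ^ p + D ^ p * E) := by
    intro a b hab
    rw [← he]
    refine (Real.rpow_le_rpow (abs_nonneg a) ?_ hp0.le).trans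
      (add_rpow_le_two_rpow_mul hp0.le (abs_nonneg b) (by positivity))
    linarith [abs_sub_abs_le_abs_sub a b]
  -- A Poincaré-type bound: comparing the mean with the trace and integrating against `w` controls
  -- the mean. A second comparison then passes from the mean to the point `x`.
  have hm : W * |m| ^ p ≤ K * (B + W * (D ^ p * E)) := by
    have hi := hw.integrable_mul_trace hG hp hsp hu
    calc W * |m| ^ p = ∫ y, w y * |m| ^ p ∂ν := (integral_mul_const _ _).symm
      _ ≤ ∫ y, K * (w y * |trace G u y| ^ p + w y * (D ^ p * E)) ∂ν := by
          refine integral_mono_ae (hw.integrable.mul_const _)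
            ((hi.add (hw.integrable.mul_const _)).const_mul K) ?_
          filter_upwards [hw.mem_closure, hw.nonneg] with y hy hwy
          have := mul_le_mul_of_nonneg_left (comparison m _ (hosc y hy)) hwy
          linarith
      _ = _ := by
          rw [integral_const_mul, integral_add hi (hw.integrable.mul_const _), integral_mul_const]
          rfl
  have hm' : |m| ^ p ≤ K * (B / W + D ^ p * E) := by
    refine le_of_mul_le_mul_left (hm.trans (le_of_eq ?_)) hW
    field_simp
  have hx' := comparison _ _ ((abs_sub_comm _ _).trans_le (hosc x hx))
  have hQ : fullSeminorm s p G ν w u = E + B := rfl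
  calc |trace G u x| ^ p ≤ K * (|m| ^ p + D ^ p * E) := hx'
    _ ≤ K * (K * (B / W + D ^ p * E) + D ^ p * E) := by gcongr
    _ ≤ K * (K * ((E + B) / W + D ^ p * (E + B)) + D ^ p * (E + B)) := by
        gcongr <;> linarith
    _ = _ := by rw [hQ]; ring

/-- This carries uniform convergence in `G` over to the traces. -/
lemma MeasureDense.abs_trace_le_of_ae_le (hG : MeasureDense G c R) (hp : 1 ≤ p)
    (hsp : 2 < s * p) (hu : FiniteGagliardo s p G u) {x : Plane} (hx : x ∈ closure G) {η : ℝ}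
    (hη : ∀ᵐ y ∂(volume.restrict G), |u y| ≤ η) (hη0 : 0 ≤ η) : |trace G u x| ≤ η := by
  refine le_of_tendsto (hG.tendsto_trace hp hsp hu hx).abs (Eventually.of_forall fun r => ?_)
  have hfin : volume (Metric.ball x r ∩ G) < ⊤ :=
    (measure_mono inter_subset_left).trans_lt measure_ball_lt_top
  have h := norm_setIntegral_le_of_norm_le_const_ae (f := u) (C := η) hfin
    (ae_mono (Measure.restrict_mono inter_subset_right le_rfl) hη)
  rw [setAverage_eq, smul_eq_mul, abs_mul, abs_of_nonneg (by positivity), inv_mul_eq_div]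
  exact div_le_of_le_mul₀ measureReal_nonneg hη0 h

lemma MeasureDense.memLp (hG : MeasureDense G c R) (hp : 1 ≤ p)
    (hsp : 2 < s * p) (hu : FiniteGagliardo s p G u) (q : ENNReal) :
    MemLp u q (volume.restrict G) := by
  have : IsFiniteMeasure (volume.restrict G) := ⟨by simpa using hG.volume_ne_top.lt_top⟩
  refine MemLp.of_bound hu.integrable.aestronglyMeasurable
    (|⨍ y in G, u y| + oscConst s p c R * gagliardo s p G u ^ (1 / p)) ?_
  filter_upwards [hG.trace_ae_eq hp hsp hu, ae_restrict_mem hG.isOpen.measurableSet] with x hx hxG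
  have := hG.abs_average_sub_trace_le hp hsp hu (subset_closure hxG)
  rw [abs_sub_comm, hx] at this
  have h2 := abs_sub_abs_le_abs_sub (u x) (⨍ y in G, u y)
  rw [Real.norm_eq_abs]
  linarith

variable {f : Plane → ℝ}

/-! ### Minimization over an order interval -/

/-- The functional to be minimized, on functions. -/
noncomputable def obstacleEnergy (s p : ℝ) (G : Set Plane) (ν : Measure Plane)
    (w f u : Plane → ℝ) : ℝ :=
  1 / p * fullSeminorm s p G ν w u - ∫ x in G, f x * u x

/-- Functions with finite Gagliardo integral between two obstacles. -/
def obstacleSet (s p : ℝ) (G : Set Plane) (φ₁ φ₂ : Plane → ℝ) : Set (Plane → ℝ) :=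
  {u | FiniteGagliardo s p G u ∧ ∀ᵐ x ∂(volume.restrict G), φ₁ x ≤ u x ∧ u x ≤ φ₂ x}

/-- The trace bound also holds for `u`, which equals its trace a.e. The free bound `q` serves
uniqueness (`q = 0`), Cauchy estimates and uniform bounds alike. -/
lemma BoundaryWeight.exists_ae_rpow_le (hw : BoundaryWeight G ν w) (hG : MeasureDense G c R)
    (hp : 1 ≤ p) (hsp : 2 < s * p) :
    ∃ C, 0 ≤ C ∧ ∀ u, FiniteGagliardo s p G u → ∀ q, fullSeminorm s p G ν w u ≤ q →
      (∀ x ∈ closure G, |trace G u x| ≤ (C * q) ^ (1 / p)) ∧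
      ∀ᵐ x ∂(volume.restrict G), |u x| ≤ (C * q) ^ (1 / p) := by
  obtain ⟨C, hC, h⟩ := hw.exists_trace_rpow_le hG hp hsp
  refine ⟨C, hC, fun u hu q hq => ?_⟩
  have hp0 : 0 < p := by linarith
  have key : ∀ x ∈ closure G, |trace G u x| ≤ (C * q) ^ (1 / p) := fun x hx => by
    have h1 := Real.rpow_le_rpow (by positivity)
      ((h u hu x hx).trans (mul_le_mul_of_nonneg_left hq hC)) (z := 1 / p) (by positivity)
    rwa [← Real.rpow_mul (abs_nonneg _), mul_one_div_cancel hp0.ne', Real.rpow_one] at h1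
  refine ⟨key, ?_⟩
  filter_upwards [hG.trace_ae_eq hp hsp hu, ae_restrict_mem hG.isOpen.measurableSet] with x hx hxG
  rw [← hx]
  exact key x (subset_closure hxG)

lemma MeasureDense.integrable_mul (hG : MeasureDense G c R) (hp : 1 ≤ p) (hsp : 2 < s * p)
    (hf : IntegrableOn f G) (hu : FiniteGagliardo s p G u) :
    IntegrableOn (fun x => f x * u x) G :=
  hf.mul_of_top_left (hG.memLp hp hsp hu ⊤)

lemma abs_setIntegral_mul_le (hf : IntegrableOn f G)
    {η : ℝ} (hη : ∀ᵐ x ∂(volume.restrict G), |u x| ≤ η) :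
    |∫ x in G, f x * u x| ≤ (∫ x in G, |f x|) * η := by
  rw [← integral_mul_const, ← Real.norm_eq_abs]
  refine norm_integral_le_of_norm_le (hf.abs.mul_const η) ?_
  filter_upwards [hη] with x hx
  rw [norm_mul, Real.norm_eq_abs, Real.norm_eq_abs]
  gcongr

/-- Coercivity of the energy. -/
lemma BoundaryWeight.exists_le_obstacleEnergy (hw : BoundaryWeight G ν w)
    (hG : MeasureDense G c R) (hp : 2 ≤ p) (hsp : 2 < s * p) (hf : IntegrableOn f G) :
    ∃ M, ∀ u, FiniteGagliardo s p G u →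
      fullSeminorm s p G ν w u / (2 * p) - M ≤ obstacleEnergy s p G ν w f u := by
  obtain ⟨C, hC, h⟩ := hw.exists_ae_rpow_le hG (by linarith) hsp
  have hp0 : 0 < p := by linarith
  have hpq : p.HolderConjugate p.conjExponent := .conjExponent (by linarith)
  set F := ∫ x in G, |f x|
  have hF : 0 ≤ F := integral_nonneg fun x => abs_nonneg _
  -- Half the constant from Young's inequality; the factor `2` inside makes the source term absorb
  -- only half of `Q / p`.
  refine ⟨(2 * (F * C ^ (1 / p))) ^ p.conjExponent / p.conjExponent / 2, fun u hu => ?_⟩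
  have hQ := hw.fullSeminorm_nonneg (s := s) (p := p) u
  have h1 := (h u hu _ le_rfl).2
  set Q := fullSeminorm s p G ν w u with hQdef
  have h2 := abs_setIntegral_mul_le hf h1
  rw [Real.mul_rpow hC hQ] at h2
  have h3 := Real.young_inequality_of_nonneg (a := Q ^ (1 / p)) (b := 2 * (F * C ^ (1 / p)))
    (by positivity) (by positivity) hpq
  rw [← Real.rpow_mul hQ, one_div_mul_cancel hp0.ne', Real.rpow_one] at h3
  have h4 : ∫ x in G, f x * u x ≤ F * (C ^ (1 / p) * Q ^ (1 / p)) := (le_abs_self _).trans h2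
  have h5 : Q / (2 * p) = Q / p / 2 := by field_simp
  have h6 : obstacleEnergy s p G ν w f u = Q / p - ∫ x in G, f x * u x := by
    rw [obstacleEnergy, ← hQdef]; ring
  rw [h5, h6]
  nlinarith

/-- Uniform convexity of the energy. -/
lemma BoundaryWeight.obstacleEnergy_midpoint_le (hw : BoundaryWeight G ν w)
    (hG : MeasureDense G c R) (hp : 2 ≤ p) (hsp : 2 < s * p) (hf : IntegrableOn f G)
    (hu : FiniteGagliardo s p G u) (hv : FiniteGagliardo s p G v) :
    obstacleEnergy s p G ν w f (fun y => 1 / 2 * u y + 1 / 2 * v y) +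
      1 / p * fullSeminorm s p G ν w (fun y => 1 / 2 * u y + -(1 / 2) * v y) ≤
      1 / 2 * obstacleEnergy s p G ν w f u + 1 / 2 * obstacleEnergy s p G ν w f v := by
  have h1 := mul_le_mul_of_nonneg_left (hw.fullSeminorm_clarkson hG hp hsp hu hv)
    (by positivity : 0 ≤ 1 / p)
  have hiu := hG.integrable_mul (by linarith) hsp hf hu
  have hiv := hG.integrable_mul (by linarith) hsp hf hv
  have h2 : ∫ x in G, f x * (1 / 2 * u x + 1 / 2 * v x) =
      1 / 2 * (∫ x in G, f x * u x) + 1 / 2 * ∫ x in G, f x * v x := by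
    rw [← integral_const_mul, ← integral_const_mul,
      ← integral_add (hiu.const_mul _) (hiv.const_mul _)]
    congr 1
    funext x
    ring
  unfold obstacleEnergy
  rw [h2]
  linarith

lemma obstacleSet_midpoint (hp : 0 ≤ p) {φ₁ φ₂ : Plane → ℝ} (hu : u ∈ obstacleSet s p G φ₁ φ₂)
    (hv : v ∈ obstacleSet s p G φ₁ φ₂) :
    (fun y => 1 / 2 * u y + 1 / 2 * v y) ∈ obstacleSet s p G φ₁ φ₂ := by
  refine ⟨hu.1.linear hp hv.1 _ _, ?_⟩
  filter_upwards [hu.2, hv.2] with x h1 h2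
  constructor <;> linarith [h1.1, h1.2, h2.1, h2.2]

/-- The midpoint competes with both minimizers, so the half difference has zero seminorm and
vanishes a.e. by the sup bound. -/
lemma BoundaryWeight.ae_eq_of_minimizers (hw : BoundaryWeight G ν w)
    (hG : MeasureDense G c R) (hp : 2 ≤ p) (hsp : 2 < s * p) (hf : IntegrableOn f G)
    {φ₁ φ₂ : Plane → ℝ} (hu : u ∈ obstacleSet s p G φ₁ φ₂) (hv : v ∈ obstacleSet s p G φ₁ φ₂)
    (hmu : ∀ z ∈ obstacleSet s p G φ₁ φ₂,
      obstacleEnergy s p G ν w f u ≤ obstacleEnergy s p G ν w f z)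
    (hmv : ∀ z ∈ obstacleSet s p G φ₁ φ₂,
      obstacleEnergy s p G ν w f v ≤ obstacleEnergy s p G ν w f z) :
    u =ᵐ[volume.restrict G] v := by
  have hp0 : 0 < p := by linarith
  obtain ⟨C, hC, h⟩ := hw.exists_ae_rpow_le hG (by linarith) hsp
  have hmid := obstacleSet_midpoint hp0.le hu hv
  have h1 := hw.obstacleEnergy_midpoint_le hG hp hsp hf hu.1 hv.1
  have h2 := hmu _ hmid
  have h3 := hmv _ hmid
  have h4 : fullSeminorm s p G ν w (fun y => 1 / 2 * u y + -(1 / 2) * v y) ≤ 0 := by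
    refine nonpos_of_mul_nonpos_right (a := 1 / p) ?_ (by positivity)
    linarith
  filter_upwards [(h _ (hu.1.linear hp0.le hv.1 _ _) 0 h4).2] with x hx
  rw [mul_zero, Real.zero_rpow (one_div_pos.2 hp0).ne'] at hx
  have := abs_nonpos_iff.1 hx
  linarith

/-- A sequence whose half differences have small seminorm converges uniformly a.e. -/
lemma BoundaryWeight.exists_uniform_limit (hw : BoundaryWeight G ν w)
    (hG : MeasureDense G c R) (hp : 2 ≤ p) (hsp : 2 < s * p) {y : ℕ → Plane → ℝ}
    (hy : ∀ k, FiniteGagliardo s p G (y k)) {ε : ℕ → ℝ} (hε : Tendsto ε atTop (𝓝 0))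
    (h : ∀ k l N, N ≤ k → N ≤ l →
      fullSeminorm s p G ν w (fun x => 1 / 2 * y k x + -(1 / 2) * y l x) ≤ ε N) :
    ∃ (U : Plane → ℝ) (η : ℕ → ℝ), StronglyMeasurable U ∧ Tendsto η atTop (𝓝 0) ∧
      (∀ k, 0 ≤ η k) ∧ ∀ᵐ x ∂(volume.restrict G), ∀ k, |y k x - U x| ≤ η k := by
  have hp0 : 0 < p := by linarith
  obtain ⟨C, hC, hb⟩ := hw.exists_ae_rpow_le hG (by linarith) hsp
  set η : ℕ → ℝ := fun N => 2 * (C * ε N) ^ (1 / p) with hη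
  have hε0 : ∀ N, 0 ≤ ε N := fun N =>
    (hw.fullSeminorm_nonneg _).trans (h N N N le_rfl le_rfl)
  have hη0 : Tendsto η atTop (𝓝 0) := by
    have h1 : Tendsto (fun N => 2 * (C * ε N) ^ (1 / p)) atTop (𝓝 (2 * (C * 0) ^ (1 / p))) :=
      (((Real.continuousAt_rpow_const _ _ (Or.inr (by positivity))).tendsto).comp
        (hε.const_mul C)).const_mul 2
    rwa [mul_zero, Real.zero_rpow (one_div_pos.2 hp0).ne', mul_zero] at h1
  have hdiff : ∀ᵐ x ∂(volume.restrict G), ∀ k l N, N ≤ k → N ≤ l → |y k x - y l x| ≤ η N := by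
    simp only [ae_all_iff]
    intro k l N hk hl
    filter_upwards [(hb _ ((hy k).linear hp0.le (hy l) _ _) _ (h k l N hk hl)).2] with x hx
    have : y k x - y l x = 2 * (1 / 2 * y k x + -(1 / 2) * y l x) := by ring
    rw [this, abs_mul, abs_two, hη]
    simpa using hx
  have hconv : ∀ᵐ x ∂(volume.restrict G), ∃ l, Tendsto (fun k => y k x) atTop (𝓝 l) := by
    filter_upwards [hdiff] with x hx
    exact cauchySeq_tendsto_of_complete
      (cauchySeq_of_le_tendsto_0 η (fun k l N hk hl => by
        rw [Real.dist_eq]; exact hx k l N hk hl) hη0)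
  obtain ⟨U, hU, hlim⟩ := exists_stronglyMeasurable_limit_of_tendsto_ae
    (fun k => (hy k).integrable.aestronglyMeasurable) hconv
  refine ⟨U, η, hU, hη0, fun k => by have := hε0 k; positivity, ?_⟩
  filter_upwards [hdiff, hlim] with x h1 h2 k
  refine le_of_tendsto (h2.const_sub (y k x)).abs ?_
  filter_upwards [eventually_ge_atTop k] with l hl using h1 k l k le_rfl hl

/-- Lower semicontinuity of the energy along uniformly convergent sequences. -/
lemma BoundaryWeight.obstacleEnergy_le_of_uniform_limit (hw : BoundaryWeight G ν w)
    (hG : MeasureDense G c R) (hp : 2 ≤ p) (hsp : 2 < s * p) (hf : IntegrableOn f G)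
    {y : ℕ → Plane → ℝ} (hy : ∀ k, FiniteGagliardo s p G (y k)) {U : Plane → ℝ} {η a : ℕ → ℝ}
    {m : ℝ} (hU : StronglyMeasurable U) (hη : Tendsto η atTop (𝓝 0)) (hη0 : ∀ k, 0 ≤ η k)
    (hyU : ∀ᵐ x ∂(volume.restrict G), ∀ k, |y k x - U x| ≤ η k)
    (ha : Tendsto a atTop (𝓝 m)) (hya : ∀ k, obstacleEnergy s p G ν w f (y k) ≤ a k) :
    FiniteGagliardo s p G U ∧ obstacleEnergy s p G ν w f U ≤ m := by
  have hp0 : 0 < p := by linarith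
  have hp1 : 1 ≤ p := by linarith
  have hfin : IsFiniteMeasure (volume.restrict G) := ⟨by simpa using hG.volume_ne_top.lt_top⟩
  obtain ⟨M, hM⟩ := hw.exists_le_obstacleEnergy hG hp hsp hf
  obtain ⟨A, hA⟩ := ha.bddAbove_range
  obtain ⟨C, hC, hb⟩ := hw.exists_ae_rpow_le hG hp1 hsp
  -- Coercivity turns bounded energies into a uniform bound `L` on functions and traces, which
  -- dominates below.
  have hQ : ∀ k, fullSeminorm s p G ν w (y k) ≤ 2 * p * (A + M) := fun k => by
    have h1 := hM _ (hy k)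
    have h2 : a k ≤ A := hA ⟨k, rfl⟩
    have h3 : fullSeminorm s p G ν w (y k) / (2 * p) ≤ A + M := by linarith [hya k]
    rw [div_le_iff₀ (by positivity)] at h3
    linarith
  set L := (C * (2 * p * (A + M))) ^ (1 / p)
  have hlim : ∀ᵐ x ∂(volume.restrict G), Tendsto (fun k => y k x) atTop (𝓝 (U x)) := by
    filter_upwards [hyU] with x hx
    exact tendsto_iff_dist_tendsto_zero.2
      (squeeze_zero (fun _ => dist_nonneg) (fun k => by rw [Real.dist_eq]; exact hx k) hη)
  have hlim2 : ∀ᵐ z ∂((volume.restrict G).prod (volume.restrict G)),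
      Tendsto (fun k => gagliardoKernel s p (y k) z) atTop (𝓝 (gagliardoKernel s p U z)) := by
    filter_upwards [Measure.quasiMeasurePreserving_fst.ae hlim,
      Measure.quasiMeasurePreserving_snd.ae hlim] with z h1 h2
    exact (((Real.continuousAt_rpow_const _ _ (Or.inr hp0.le)).tendsto).comp
      (h1.sub h2).abs).div_const _
  have hUfin : FiniteGagliardo s p G U := by
    refine ⟨?_, (integrable_and_integral_le_of_tendsto (fun k => (hy k).kernel)
      (fun k => gagliardoKernel_nonneg s p _) hlim2
      (fun k => (hw.gagliardo_le (y k)).trans (hQ k)) tendsto_const_nhds).1⟩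
    have h1 : IntegrableOn (fun x => y 0 x - U x) G :=
      Integrable.of_bound ((hy 0).integrable.aestronglyMeasurable.sub hU.aestronglyMeasurable)
        (η 0) (hyU.mono fun x hx => hx 0)
    exact ((hy 0).integrable.sub h1).congr (Eventually.of_forall fun x => by simp)
  refine ⟨hUfin, ?_⟩
  have htrace : ∀ x ∈ closure G, Tendsto (fun k => trace G (y k) x) atTop (𝓝 (trace G U x)) := by
    intro x hx
    refine tendsto_iff_dist_tendsto_zero.2 (squeeze_zero (fun _ => dist_nonneg) (fun k => ?_) hη)
    have h1 := hG.abs_trace_le_of_ae_le hp1 hsp ((hy k).linear hp0.le hUfin 1 (-1)) hx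
      (hyU.mono fun x hx => by simpa [← sub_eq_add_neg] using hx k) (hη0 k)
    rw [hG.trace_linear hp1 hsp (hy k) hUfin _ _ hx] at h1
    rw [Real.dist_eq]
    convert h1 using 2
    ring
  have hB : Tendsto (fun k => boundaryTerm p G ν w (y k)) atTop (𝓝 (boundaryTerm p G ν w U)) := by
    refine tendsto_integral_of_dominated_convergence (fun x => w x * L ^ p)
      (fun k => (hw.integrable_mul_trace hG hp1 hsp (hy k)).aestronglyMeasurable)
      (hw.integrable.mul_const _) (fun k => ?_) ?_
    · filter_upwards [hw.mem_closure, hw.nonneg] with x hx hwx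
      rw [Real.norm_of_nonneg (by positivity)]
      gcongr
      exact (hb _ (hy k) _ (hQ k)).1 x hx
    · filter_upwards [hw.mem_closure] with x hx
      exact (((Real.continuousAt_rpow_const _ _ (Or.inr hp0.le)).tendsto).comp
        (htrace x hx).abs).const_mul _
  have hF : Tendsto (fun k => ∫ x in G, f x * y k x) atTop (𝓝 (∫ x in G, f x * U x)) := by
    refine tendsto_integral_of_dominated_convergence (fun x => |f x| * L)
      (fun k => (hG.integrable_mul hp1 hsp hf (hy k)).aestronglyMeasurable)
      (hf.abs.mul_const _) (fun k => ?_) ?_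
    · filter_upwards [(hb _ (hy k) _ (hQ k)).2] with x hx
      rw [norm_mul, Real.norm_eq_abs, Real.norm_eq_abs]
      gcongr
    · filter_upwards [hlim] with x hx using hx.const_mul _
  -- Fatou for the Gagliardo part alone: solving the energy bound for it leaves convergent upper
  -- bounds.
  have hE := (integrable_and_integral_le_of_tendsto (fun k => (hy k).kernel)
    (fun k => gagliardoKernel_nonneg s p _) hlim2
    (a := fun k => p * (a k + ∫ x in G, f x * y k x) - boundaryTerm p G ν w (y k)) (fun k => ?_)
    (((ha.add hF).const_mul p).sub hB)).2
  · have h1 : gagliardo s p G U ≤ p * (m + ∫ x in G, f x * U x) - boundaryTerm p G ν w U := hE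
    have h2 : 1 / p * fullSeminorm s p G ν w U ≤ m + ∫ x in G, f x * U x := by
      rw [one_div, inv_mul_le_iff₀ hp0, fullSeminorm]
      linarith
    unfold obstacleEnergy
    linarith
  · have h1 : 1 / p * fullSeminorm s p G ν w (y k) ≤ a k + ∫ x in G, f x * y k x := by
      have := hya k
      unfold obstacleEnergy at this
      linarith
    rw [one_div, inv_mul_le_iff₀ hp0, fullSeminorm] at h1
    change gagliardo s p G (y k) ≤ _
    linarith

/-- Existence of a minimizer between two obstacles. -/
theorem BoundaryWeight.exists_minimizer (hw : BoundaryWeight G ν w)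
    (hG : MeasureDense G c R) (hp : 2 ≤ p) (hsp : 2 < s * p) (hf : IntegrableOn f G)
    {φ₁ φ₂ : Plane → ℝ} (hne : (obstacleSet s p G φ₁ φ₂).Nonempty) :
    ∃ u ∈ obstacleSet s p G φ₁ φ₂, ∀ v ∈ obstacleSet s p G φ₁ φ₂,
      obstacleEnergy s p G ν w f u ≤ obstacleEnergy s p G ν w f v := by
  have hp0 : 0 < p := by linarith
  set K := obstacleSet s p G φ₁ φ₂
  set J := obstacleEnergy s p G ν w f
  obtain ⟨M, hM⟩ := hw.exists_le_obstacleEnergy hG hp hsp hf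
  have hbdd : BddBelow (J '' K) := by
    refine ⟨-M, ?_⟩
    rintro _ ⟨u, hu, rfl⟩
    have h1 := hM u hu.1
    have h2 : 0 ≤ fullSeminorm s p G ν w u / (2 * p) :=
      div_nonneg (hw.fullSeminorm_nonneg u) (by positivity)
    change -M ≤ obstacleEnergy s p G ν w f u
    linarith
  set m := sInf (J '' K)
  have hm : ∀ v ∈ K, m ≤ J v := fun v hv => csInf_le hbdd ⟨v, hv, rfl⟩
  have hseq : ∀ k : ℕ, ∃ u ∈ K, J u ≤ m + 1 / (k + 1) := fun k => by
    obtain ⟨_, ⟨u, hu, rfl⟩, h⟩ := exists_lt_of_csInf_lt (hne.image J)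
      (lt_add_of_pos_right m (Nat.one_div_pos_of_nat (α := ℝ) (n := k)))
    exact ⟨u, hu, h.le⟩
  choose y hyK hyJ using hseq
  -- Beyond index `N` the energies are at most `m + 1 / (N + 1)` and midpoints have energy at least
  -- `m`, so `1 / p` times the seminorm of a half difference is at most `1 / (N + 1)`.
  have hε : Tendsto (fun k : ℕ => p * (1 / ((k : ℝ) + 1))) atTop (𝓝 0) := by
    simpa using (tendsto_one_div_add_atTop_nhds_zero_nat (𝕜 := ℝ)).const_mul p
  obtain ⟨U, η, hU, hη, hη0, hyU⟩ := hw.exists_uniform_limit hG hp hsp (fun k => (hyK k).1) hε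
    (fun k l N hk hl => by
      have h1 := hw.obstacleEnergy_midpoint_le hG hp hsp hf (hyK k).1 (hyK l).1
      have h2 := hm _ (obstacleSet_midpoint hp0.le (hyK k) (hyK l))
      have h3 := hyJ k
      have h4 := hyJ l
      have h5 := Nat.one_div_le_one_div (α := ℝ) hk
      have h6 := Nat.one_div_le_one_div (α := ℝ) hl
      rw [← inv_mul_le_iff₀ hp0, ← one_div]
      change m ≤ obstacleEnergy s p G ν w f _ at h2
      change obstacleEnergy s p G ν w f _ ≤ _ at h3
      change obstacleEnergy s p G ν w f _ ≤ _ at h4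
      linarith)
  have ha : Tendsto (fun k : ℕ => m + 1 / ((k : ℝ) + 1)) atTop (𝓝 m) := by
    simpa using (tendsto_one_div_add_atTop_nhds_zero_nat (𝕜 := ℝ)).const_add m
  obtain ⟨hUfin, hUm⟩ := hw.obstacleEnergy_le_of_uniform_limit hG hp hsp hf (fun k => (hyK k).1)
    hU hη hη0 hyU ha hyJ
  refine ⟨U, ⟨hUfin, ?_⟩, fun v hv => hUm.trans (hm v hv)⟩
  filter_upwards [hyU, ae_all_iff.2 fun k => (hyK k).2] with x h1 h2
  have h3 : Tendsto (fun k => y k x) atTop (𝓝 (U x)) :=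
    tendsto_iff_dist_tendsto_zero.2
      (squeeze_zero (fun _ => dist_nonneg) (fun k => by rw [Real.dist_eq]; exact h1 k) hη)
  exact ⟨ge_of_tendsto' h3 fun k => (h2 k).1, le_of_tendsto' h3 fun k => (h2 k).2⟩

/-! ### Regions with measure density and boundary of finite length -/

/-- A compact region whose interior is measure dense and whose frontier has finite length. -/
structure GoodRegion (S : Set Plane) : Prop where
  isCompact : IsCompact S
  frontier_lt_top : Measure.hausdorffMeasure 1 (frontier S) < ⊤
  density : ∃ c > 0, ∃ R > 0, ∀ x ∈ S, ∀ r, 0 < r → r ≤ R →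
    c * r ^ 2 ≤ volume.real (Metric.ball x r ∩ interior S)

lemma GoodRegion.empty : GoodRegion ∅ :=
  ⟨isCompact_empty, by simp, 1, one_pos, 1, one_pos, by simp⟩

/-- Density at `x` needs only the piece containing `x`. How the pieces meet is irrelevant, so no
finer geometry of the Koch curve is required. -/
lemma GoodRegion.union {S T : Set Plane} (hS : GoodRegion S) (hT : GoodRegion T) :
    GoodRegion (S ∪ T) := by
  refine ⟨hS.isCompact.union hT.isCompact, ?_, ?_⟩
  · have h : frontier (S ∪ T) ⊆ frontier S ∪ frontier T :=
      (frontier_union_subset S T).trans (union_subset_union inter_subset_left inter_subset_right)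
    exact (measure_mono h).trans_lt
      (measure_union_lt_top hS.frontier_lt_top hT.frontier_lt_top)
  · obtain ⟨c, hc, R, hR, h⟩ := hS.density
    obtain ⟨c', hc', R', hR', h'⟩ := hT.density
    refine ⟨min c c', lt_min hc hc', min R R', lt_min hR hR', fun x hx r hr hrR => ?_⟩
    have hfin : volume (Metric.ball x r ∩ interior (S ∪ T)) ≠ ⊤ :=
      ((measure_mono inter_subset_left).trans_lt measure_ball_lt_top).ne
    rcases hx with hx | hx
    · calc min c c' * r ^ 2 ≤ c * r ^ 2 := by gcongr; exact min_le_left _ _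
        _ ≤ _ := h x hx r hr (hrR.trans (min_le_left _ _))
        _ ≤ _ := measureReal_mono (inter_subset_inter_right _
            (interior_mono subset_union_left)) hfin
    · calc min c c' * r ^ 2 ≤ c' * r ^ 2 := by gcongr; exact min_le_right _ _
        _ ≤ _ := h' x hx r hr (hrR.trans (min_le_right _ _))
        _ ≤ _ := measureReal_mono (inter_subset_inter_right _
            (interior_mono subset_union_right)) hfin

lemma GoodRegion.biUnion_list {α : Type*} (l : List α) {S : α → Set Plane}
    (h : ∀ a ∈ l, GoodRegion (S a)) : GoodRegion (⋃ a ∈ l, S a) := by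
  induction l with
  | nil => simpa using GoodRegion.empty
  | cons a l ih =>
    have : (⋃ b ∈ a :: l, S b) = S a ∪ ⋃ b ∈ l, S b := by
      ext x; simp
    rw [this]
    exact (h a (by simp)).union (ih fun b hb => h b (by simp [hb]))

/-- Convex bodies are measure dense. -/
lemma exists_density_of_convex {K : Set Plane} (hK : Convex ℝ K) (hb : Bornology.IsBounded K)
    (hne : (interior K).Nonempty) :
    ∃ c > 0, ∃ R > 0, ∀ x ∈ K, ∀ r, 0 < r → r ≤ R →
      c * r ^ 2 ≤ volume.real (Metric.ball x r ∩ interior K) := by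
  obtain ⟨z, hz⟩ := hne
  obtain ⟨ρ, hρ, hball⟩ := Metric.isOpen_iff.1 isOpen_interior z hz
  obtain ⟨D₀, hD₀⟩ := hb.subset_closedBall z
  have hD₀0 : 0 ≤ D₀ := dist_nonneg.trans (hD₀ (interior_subset hz))
  set D := D₀ + ρ
  have hD : 0 < D := by positivity
  have hunit : 0 < volume.real (Metric.ball (0 : Plane) 1) :=
    ENNReal.toReal_pos (Metric.measure_ball_pos volume _ one_pos).ne' measure_ball_lt_top.ne
  refine ⟨(ρ / D) ^ 2 * volume.real (Metric.ball (0 : Plane) 1), by positivity, D, hD,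
    fun x hx r hr hrD => ?_⟩
  -- The homothety centered at `x` with ratio `t` sends the inner ball `B(z, ρ)` into `K` by
  -- convexity, and into `B(x, r)` because `D` exceeds the distance from `x` to its points.
  set t := r / D with ht
  have ht0 : 0 < t := by positivity
  have ht1 : t ≤ 1 := (div_le_one hD).2 hrD
  have htD : t * D = r := by rw [ht]; field_simp
  have hsub : Metric.ball ((1 - t) • x + t • z) (t * ρ) ⊆ Metric.ball x r ∩ interior K := by
    have h1 : Metric.ball ((1 - t) • x + t • z) (t * ρ) ⊆ K := by
      intro q hq
      have hq' : z + t⁻¹ • (q - ((1 - t) • x + t • z)) ∈ Metric.ball z ρ := by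
        rw [mem_ball_iff_norm] at hq ⊢
        rw [add_sub_cancel_left, norm_smul, Real.norm_of_nonneg (by positivity),
          inv_mul_lt_iff₀ ht0]
        exact hq
      have := hK hx (interior_subset (hball hq')) (by linarith : 0 ≤ 1 - t) ht0.le (by ring)
      convert this using 1
      rw [smul_add, smul_smul, mul_inv_cancel₀ ht0.ne']
      module
    refine subset_inter (fun q hq => ?_) (interior_maximal h1 Metric.isOpen_ball)
    rw [mem_ball_iff_norm] at hq ⊢
    have h2 : ‖z - x‖ ≤ D₀ := by
      rw [← dist_eq_norm, dist_comm]; exact hD₀ hx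
    calc ‖q - x‖ = ‖(q - ((1 - t) • x + t • z)) + t • (z - x)‖ := by congr 1; module
      _ ≤ ‖q - ((1 - t) • x + t • z)‖ + t * ‖z - x‖ := by
          refine (norm_add_le _ _).trans (le_of_eq ?_)
          rw [norm_smul, Real.norm_of_nonneg ht0.le]
      _ < t * ρ + t * D₀ := add_lt_add_of_lt_of_le hq (by gcongr)
      _ = r := by rw [← htD]; ring
  have hvol : volume.real (Metric.ball ((1 - t) • x + t • z) (t * ρ)) =
      (t * ρ) ^ 2 * volume.real (Metric.ball (0 : Plane) 1) := by
    rw [measureReal_def, Measure.addHaar_ball _ _ (by positivity), ENNReal.toReal_mul,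
      ENNReal.toReal_ofReal (by positivity), finrank_euclideanSpace_fin, measureReal_def]
  calc _ = (t * ρ) ^ 2 * volume.real (Metric.ball (0 : Plane) 1) := by
        rw [ht]; field_simp
    _ = _ := hvol.symm
    _ ≤ _ := measureReal_mono hsub
        ((measure_mono inter_subset_left).trans_lt measure_ball_lt_top).ne

/-- The basis of the plane given by the vertices of a nondegenerate triangle. -/
lemma exists_affineBasis_of_cross_ne_zero {A B C : Plane}
    (h : (B - A) 0 * (C - A) 1 - (B - A) 1 * (C - A) 0 ≠ 0) :
    ∃ b : AffineBasis (Fin 3) ℝ Plane, ⇑b = ![A, B, C] := by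
  have hind : AffineIndependent ℝ ![A, B, C] := by
    rw [affineIndependent_iff_not_collinear_set,
      collinear_iff_of_mem (p₀ := A) (by simp)]
    rintro ⟨v, hv⟩
    obtain ⟨r, hr⟩ := hv B (by simp)
    obtain ⟨r', hr'⟩ := hv C (by simp)
    refine h ?_
    rw [hr, hr']
    simp
    ring
  refine ⟨⟨_, hind, ?_⟩, rfl⟩
  rw [hind.affineSpan_eq_top_iff_card_eq_finrank_add_one]
  simp

lemma range_vec3 {α : Type*} (A B C : α) : range ![A, B, C] = {A, B, C} := by
  rw [Matrix.range_cons, Matrix.range_cons, Matrix.range_cons, Matrix.range_empty, union_empty]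
  rfl

/-- Interior points have all barycentric coordinates positive, so at a frontier point one vanishes.
-/
lemma frontier_convexHull_triangle_subset {A B C : Plane} {b : AffineBasis (Fin 3) ℝ Plane}
    (hb : ⇑b = ![A, B, C]) :
    frontier (convexHull ℝ {A, B, C}) ⊆ segment ℝ A B ∪ segment ℝ B C ∪ segment ℝ A C := by
  intro x hx
  have hclosed : IsClosed (convexHull ℝ ({A, B, C} : Set Plane)) :=
    (Set.toFinite _).isClosed_convexHull ℝ
  rw [hclosed.frontier_eq, ← range_vec3, ← hb, b.interior_convexHull,
    b.convexHull_eq_nonneg_coord] at hx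
  obtain ⟨h1, h2⟩ := hx
  simp only [mem_ofPred_eq, not_forall, not_lt] at h1 h2
  obtain ⟨i, hi⟩ := h2
  have hi0 := le_antisymm hi (h1 i)
  have hsum := b.sum_coord_apply_eq_one x
  have hx := b.linear_combination_coord_eq_self x
  rw [Fin.sum_univ_three] at hsum hx
  simp only [hb] at hx
  simp only [Matrix.cons_val_zero, Matrix.cons_val_one, Matrix.cons_val] at hx
  have h0 := h1 0
  have h1' := h1 1
  have h2 := h1 2
  fin_cases i
  · refine Or.inl (Or.inr ⟨_, _, h1', h2, ?_, ?_⟩)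
    · simp_all
    · simp_all
  · refine Or.inr ⟨_, _, h0, h2, ?_, ?_⟩
    · simp_all
    · simp_all
  · refine Or.inl (Or.inl ⟨_, _, h0, h1', ?_, ?_⟩)
    · simp_all
    · simp_all

lemma goodRegion_triangle {A B C : Plane}
    (h : (B - A) 0 * (C - A) 1 - (B - A) 1 * (C - A) 0 ≠ 0) :
    GoodRegion (convexHull ℝ {A, B, C}) ∧ (interior (convexHull ℝ {A, B, C})).Nonempty := by
  obtain ⟨b, hb⟩ := exists_affineBasis_of_cross_ne_zero h
  have hne : (interior (convexHull ℝ {A, B, C})).Nonempty := by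
    rw [← range_vec3, ← hb]
    exact ⟨_, b.centroid_mem_interior_convexHull⟩
  have hcpt : IsCompact (convexHull ℝ {A, B, C}) := (Set.toFinite _).isCompact_convexHull ℝ
  refine ⟨⟨hcpt, ?_, exists_density_of_convex (convex_convexHull ℝ _) hcpt.isBounded hne⟩, hne⟩
  refine (measure_mono (frontier_convexHull_triangle_subset hb)).trans_lt ?_
  refine measure_union_lt_top (measure_union_lt_top ?_ ?_) ?_ <;>
  · rw [hausdorffMeasure_segment]
    exact edist_lt_top _ _

/-- The interior of a good region is measure dense. -/
lemma GoodRegion.exists_measureDense {S : Set Plane} (hS : GoodRegion S) :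
    ∃ c R, MeasureDense (interior S) c R := by
  obtain ⟨c, hc, R, hR, h⟩ := hS.density
  obtain ⟨D, hD⟩ := Metric.isBounded_iff.1 hS.isCompact.isBounded
  -- `MeasureDense` needs a scale beyond the diameter; shrinking radii by `R / R'` returns to the
  -- known range at the cost of `(R / R') ^ 2`.
  set R' := max R (D + 1)
  have hR' : 0 < R' := lt_max_of_lt_left hR
  have hcl : closure (interior S) ⊆ S := hS.isCompact.isClosed.closure_interior_subset
  refine ⟨c * (R / R') ^ 2, R', isOpen_interior, by positivity, hR', fun x hx y hy => ?_,
    fun x hx r hr hrR => ?_⟩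
  · have := hD (interior_subset hy) (hcl hx)
    have h2 := le_max_right R (D + 1)
    exact Metric.mem_ball.2 (by change _ < max R (D + 1); linarith)
  · have h1 : R / R' ≤ 1 := (div_le_one hR').2 (le_max_left _ _)
    have h2 := h x (hcl hx) (R / R' * r) (by positivity) (by
      calc R / R' * r ≤ R / R' * R' := by gcongr
        _ = R := by field_simp)
    calc c * (R / R') ^ 2 * r ^ 2 = c * (R / R' * r) ^ 2 := by ring
      _ ≤ _ := h2
      _ ≤ _ := measureReal_mono (inter_subset_inter_left _ (Metric.ball_subset_ball
          (mul_le_of_le_one_left hr.le h1)))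
          ((measure_mono inter_subset_left).trans_lt measure_ball_lt_top).ne

/-- The frontier of a nonempty bounded open set has positive length. -/
lemma hausdorffMeasure_frontier_pos {U : Set Plane} (hU : IsOpen U) (hne : U.Nonempty)
    (hb : Bornology.IsBounded U) :
    0 < (Measure.hausdorffMeasure 1 : Measure Plane) (frontier U) := by
  obtain ⟨x, hx⟩ := hne
  obtain ⟨ρ, hρ, hball⟩ := Metric.isOpen_iff.1 hU x hx
  have hlip : LipschitzWith 1 fun y : Plane => y 0 := by
    refine LipschitzWith.of_dist_le_mul fun y z => ?_
    rw [NNReal.coe_one, one_mul, dist_eq_norm, dist_eq_norm]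
    exact PiLp.norm_apply_le (y - z) 0
  -- Each vertical line with abscissa in this interval meets `U` and leaves it, so it crosses the
  -- frontier. The projection is 1-Lipschitz and does not increase length.
  have himg : Ioo (x 0 - ρ) (x 0 + ρ) ⊆ (fun y : Plane => y 0) '' frontier U := by
    intro t ht
    set L : ℝ → Plane := fun τ => !₂[t, x 1 + τ]
    have hL : Continuous L := by
      refine (PiLp.continuous_toLp 2 _).comp (continuous_pi fun i => ?_)
      fin_cases i <;> simp <;> fun_prop
    have h0 : L 0 ∈ U := by
      refine hball ?_
      rw [Metric.mem_ball, EuclideanSpace.dist_eq, Fin.sum_univ_two]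
      simp only [L, add_zero, Matrix.cons_val_zero, Matrix.cons_val_one,
        dist_self, Real.dist_eq, sq_abs]
      rw [zero_pow two_ne_zero, add_zero, Real.sqrt_sq_eq_abs, abs_lt]
      constructor <;> linarith [ht.1, ht.2]
    obtain ⟨D, hD⟩ := hb.subset_ball (L 0)
    have hDpos : 0 < D := Metric.nonempty_ball.1 ⟨_, hD h0⟩
    have h1 : L D ∉ U := by
      intro h
      have h2 := hD h
      rw [Metric.mem_ball, EuclideanSpace.dist_eq, Fin.sum_univ_two] at h2
      simp [L, Real.sqrt_sq_eq_abs, abs_of_pos hDpos] at h2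
    obtain ⟨τ, hτ⟩ := nonempty_frontier_iff.2 (⟨⟨0, h0⟩, (ne_univ_iff_exists_notMem _).2 ⟨D, h1⟩⟩ :
      (L ⁻¹' U).Nonempty ∧ L ⁻¹' U ≠ univ)
    exact ⟨_, hL.frontier_preimage_subset U hτ, by simp [L]⟩
  have h1 := hlip.hausdorffMeasure_image_le zero_le_one (frontier U)
  rw [ENNReal.coe_one, ENNReal.one_rpow, one_mul, hausdorffMeasure_real] at h1
  refine lt_of_lt_of_le ?_ ((measure_mono himg).trans h1)
  rw [Real.volume_Ioo, ENNReal.ofReal_pos]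
  linarith

/-! ### The pre-fractal domains -/

lemma sq_add_sq_ne_zero {d : Plane} (hd : d ≠ 0) : d 0 ^ 2 + d 1 ^ 2 ≠ 0 := by
  intro h
  refine hd ((norm_eq_zero (a := d)).1 ?_)
  rw [EuclideanSpace.norm_eq, Fin.sum_univ_two, Real.norm_eq_abs, Real.norm_eq_abs, sq_abs, sq_abs,
    h, Real.sqrt_zero]

/-- Each new edge has a nonzero component along its parent: `1/3` of it for the outer two, `1/6` for
the sides of the bump. -/
lemma ne_of_mem_kochEdges (n : ℕ) : ∀ e ∈ kochEdges n, e.2 - e.1 ≠ 0 := by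
  induction n with
  | zero =>
    intro e he
    have hne : ∀ a b : Plane, a 0 ≠ b 0 → b - a ≠ 0 := fun a b h h' => h (by
      rw [sub_eq_zero.1 h'])
    simp only [kochEdges, List.mem_cons, List.not_mem_nil, or_false] at he
    rcases he with rfl | rfl | rfl <;> refine hne _ _ ?_ <;>
      norm_num [vertexA, vertexB, vertexC]
  | succ n ih =>
    intro e he
    simp only [kochEdges, List.mem_flatMap] at he
    obtain ⟨a, ha, he⟩ := he
    have hd := ih a ha
    have hsq := sq_add_sq_ne_zero hd
    have key : ∀ v : Plane, (∃ k : ℝ, k ≠ 0 ∧ v 0 * (a.2 - a.1) 0 + v 1 * (a.2 - a.1) 1 =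
        k * ((a.2 - a.1) 0 ^ 2 + (a.2 - a.1) 1 ^ 2)) → v ≠ 0 := by
      rintro v ⟨k, hk, h⟩ rfl
      refine mul_ne_zero hk hsq (h.symm.trans ?_)
      simp
    simp only [subdivide, List.mem_cons, List.not_mem_nil, or_false] at he
    rcases he with rfl | rfl | rfl | rfl <;> refine key _ ?_
    · exact ⟨1 / 3, by norm_num, by simp [thirdLeft]; ring⟩
    · exact ⟨1 / 6, by norm_num, by
        simp [thirdLeft, apex, midpoint_eq_smul_add]; ring⟩
    · exact ⟨1 / 6, by norm_num, by
        simp [thirdRight, apex, midpoint_eq_smul_add]; ring⟩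
    · exact ⟨1 / 3, by norm_num, by simp [thirdRight]; ring⟩

lemma goodRegion_kochPolygon (n : ℕ) :
    GoodRegion (kochPolygon n) ∧ (prefractalDomain n).Nonempty := by
  induction n with
  | zero =>
    refine goodRegion_triangle ?_
    simp [vertexA, vertexB, vertexC]
  | succ n ih =>
    refine ⟨ih.1.union (GoodRegion.biUnion_list _ fun e he => (goodRegion_triangle ?_).1),
      ih.2.mono (interior_mono subset_union_left)⟩
    have hd := ne_of_mem_kochEdges n e he
    have hsq := sq_add_sq_ne_zero hd
    -- Base `1/3` times height `√3 / 6` of the erected triangle, relative to the edge.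
    have h3 : √3 / 18 ≠ 0 := by positivity
    convert mul_ne_zero h3 hsq using 1
    simp [thirdLeft, thirdRight, apex, midpoint_eq_smul_add]
    ring

variable {n : ℕ}

lemma exists_measureDense_prefractalDomain (n : ℕ) :
    ∃ c R, MeasureDense (prefractalDomain n) c R :=
  (goodRegion_kochPolygon n).1.exists_measureDense

lemma prefractalDomain_subset_snowflakeDomain (n : ℕ) :
    prefractalDomain n ⊆ snowflakeDomain := subset_iUnion prefractalDomain n

/-- A continuous positive function defines an admissible weight on the pre-fractal boundary. -/
lemma boundaryWeight_prefractalDomain {b : Plane → ℝ}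
    (hb : ContinuousOn b (closure snowflakeDomain))
    (hbpos : ∀ x ∈ closure snowflakeDomain, 0 < b x) {δ : ℝ} (hδ : 0 < δ) (n : ℕ) :
    BoundaryWeight (prefractalDomain n)
      ((Measure.hausdorffMeasure 1).restrict (frontier (prefractalDomain n)))
      (fun x => δ * b x) := by
  obtain ⟨hK, hne⟩ := goodRegion_kochPolygon n
  have hbd : Bornology.IsBounded (prefractalDomain n) :=
    hK.isCompact.isBounded.subset interior_subset
  have hfr : frontier (prefractalDomain n) ⊆ closure snowflakeDomain :=
    frontier_subset_closure.trans (closure_mono (prefractalDomain_subset_snowflakeDomain n))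
  have hcpt : IsCompact (frontier (prefractalDomain n)) :=
    hbd.isCompact_closure.of_isClosed_subset isClosed_frontier frontier_subset_closure
  have hm : MeasurableSet (frontier (prefractalDomain n)) := isClosed_frontier.measurableSet
  have hlt : (Measure.hausdorffMeasure 1 : Measure Plane) (frontier (prefractalDomain n)) < ⊤ :=
    (measure_mono frontier_interior_subset).trans_lt hK.frontier_lt_top
  have hpos := hausdorffMeasure_frontier_pos (U := prefractalDomain n) isOpen_interior hne hbd
  have hcont : ContinuousOn (fun x => δ * b x) (frontier (prefractalDomain n)) :=
    continuousOn_const.mul (hb.mono hfr)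
  have hwpos : ∀ x ∈ frontier (prefractalDomain n), 0 < δ * b x := fun x hx =>
    mul_pos hδ (hbpos x (hfr hx))
  have hint : IntegrableOn (fun x => δ * b x) (frontier (prefractalDomain n))
      (Measure.hausdorffMeasure 1) := by
    obtain ⟨C, hC⟩ := hcpt.exists_bound_of_continuousOn hcont
    exact IntegrableOn.of_bound hlt (hcont.aestronglyMeasurable hm) C
      ((ae_restrict_mem hm).mono hC)
  refine ⟨(ae_restrict_mem hm).mono fun x hx => frontier_subset_closure hx, hint,
    (ae_restrict_mem hm).mono fun x hx => (hwpos x hx).le, ?_⟩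
  rw [setIntegral_pos_iff_support_of_nonneg_ae
    ((ae_restrict_mem hm).mono fun x hx => (hwpos x hx).le) hint]
  rwa [inter_eq_right.2 fun x hx => Function.mem_support.2 (hwpos x hx).ne']

lemma energy_eq_obstacleEnergy (s p : ℝ) (n : ℕ) (δ : ℝ) (f b : Plane → ℝ)
    (u : Lp ℝ (ENNReal.ofReal p) (volume.restrict (prefractalDomain n))) :
    energy s p n δ f b u = obstacleEnergy s p (prefractalDomain n)
      ((Measure.hausdorffMeasure 1).restrict (frontier (prefractalDomain n)))
      (fun x => δ * b x) f u := by
  simp only [energy, obstacleEnergy, fullSeminorm, gagliardo, boundaryTerm, mul_assoc]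
  rw [integral_const_mul]
  ring

lemma obstacleEnergy_congr {G : Set Plane} {ν : Measure Plane} {w f u v : Plane → ℝ}
    (h : u =ᵐ[volume.restrict G] v) :
    obstacleEnergy s p G ν w f u = obstacleEnergy s p G ν w f v := by
  have h1 : ∫ x in G, f x * u x = ∫ x in G, f x * v x :=
    integral_congr_ae (h.mono fun x hx => by simp only [hx])
  have h2 : gagliardo s p G u = gagliardo s p G v :=
    integral_congr_ae (gagliardoKernel_ae_congr h)
  simp only [obstacleEnergy, fullSeminorm, boundaryTerm, h1, h2, trace_congr h]

lemma obstacleSet_congr {G : Set Plane} {φ₁ φ₂ u v : Plane → ℝ}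
    (hu : u ∈ obstacleSet s p G φ₁ φ₂) (h : u =ᵐ[volume.restrict G] v) :
    v ∈ obstacleSet s p G φ₁ φ₂ := by
  refine ⟨hu.1.congr h, ?_⟩
  filter_upwards [hu.2, h] with x h1 h2
  rwa [← h2]

/-- The domain has finite area, so `L^p` functions are integrable. -/
lemma mem_admissible_iff (hp : 1 ≤ p) {φ₁ φ₂ : Plane → ℝ}
    {u : Lp ℝ (ENNReal.ofReal p) (volume.restrict (prefractalDomain n))} :
    u ∈ admissible s p n φ₁ φ₂ ↔ ⇑u ∈ obstacleSet s p (prefractalDomain n) φ₁ φ₂ := by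
  obtain ⟨c, R, hG⟩ := exists_measureDense_prefractalDomain n
  have : IsFiniteMeasure (volume.restrict (prefractalDomain n)) :=
    ⟨by simpa using hG.volume_ne_top.lt_top⟩
  have hu : IntegrableOn u (prefractalDomain n) :=
    (Lp.memLp u).integrable (by simpa using ENNReal.ofReal_le_ofReal hp)
  exact ⟨fun h => ⟨⟨hu, h.1⟩, h.2⟩, fun h => ⟨h.1.kernel, h.2⟩⟩

end KochObstacle

open KochObstacle
theorem mainTheorem7 (s p : ℝ) (hsp : 2 < s * p) (hspp : s * p < p)
    (f : Plane → ℝ) (hf : IntegrableOn f snowflakeDomain volume)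
    (b : Plane → ℝ) (hb : ContinuousOn b (closure snowflakeDomain))
    (hbpos : ∀ x ∈ closure snowflakeDomain, 0 < b x)
    (δ : ℕ → ℝ) (hδ : ∀ n, 0 < δ n)
    (φ₁ φ₂ : ℕ → Lp ℝ (ENNReal.ofReal p) (volume.restrict snowflakeDomain))
    (hφ₁ : ∀ n, φ₁ n ∈ fracSobolev s p snowflakeDomain)
    (hφ₂ : ∀ n, φ₂ n ∈ fracSobolev s p snowflakeDomain)
    (hφ : ∀ n, ∀ᵐ x ∂(volume.restrict snowflakeDomain), φ₁ n x ≤ φ₂ n x)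
    (n : ℕ) (hK : (admissible s p n (φ₁ n) (φ₂ n)).Nonempty) :
    ∃! u : Lp ℝ (ENNReal.ofReal p) (volume.restrict (prefractalDomain n)),
      u ∈ admissible s p n (φ₁ n) (φ₂ n) ∧
        ∀ v ∈ admissible s p n (φ₁ n) (φ₂ n),
          energy s p n (δ n) f b u ≤ energy s p n (δ n) f b v := by
  have hp : 2 ≤ p := by linarith
  have hp1 : 1 ≤ p := by linarith
  obtain ⟨c, R, hG⟩ := exists_measureDense_prefractalDomain n
  have hw := boundaryWeight_prefractalDomain hb hbpos (hδ n) n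
  have hfn : IntegrableOn f (prefractalDomain n) :=
    hf.mono_set (prefractalDomain_subset_snowflakeDomain n)
  -- Competitors are bounded, hence in `L^p`, so minimizing over functions and over classes is the
  -- same problem.
  have toLp : ∀ v ∈ obstacleSet s p (prefractalDomain n) (φ₁ n) (φ₂ n),
      ∃ z : Lp ℝ (ENNReal.ofReal p) (volume.restrict (prefractalDomain n)),
        z =ᵐ[volume.restrict (prefractalDomain n)] v ∧ z ∈ admissible s p n (φ₁ n) (φ₂ n) := by
    intro v hv
    have h := (hG.memLp hp1 hsp hv.1 (ENNReal.ofReal p)).coeFn_toLp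
    exact ⟨_, h, (mem_admissible_iff hp1).2 (obstacleSet_congr hv h.symm)⟩
  obtain ⟨v₀, hv₀⟩ := hK
  obtain ⟨u₀, hu₀, hmin⟩ := hw.exists_minimizer hG hp hsp hfn
    ⟨_, (mem_admissible_iff hp1).1 hv₀⟩
  obtain ⟨u, huu₀, hu⟩ := toLp u₀ hu₀
  have humin : ∀ v ∈ admissible s p n (φ₁ n) (φ₂ n),
      energy s p n (δ n) f b u ≤ energy s p n (δ n) f b v := by
    intro v hv
    rw [energy_eq_obstacleEnergy, energy_eq_obstacleEnergy, obstacleEnergy_congr huu₀]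
    exact hmin v ((mem_admissible_iff hp1).1 hv)
  refine ⟨u, ⟨hu, humin⟩, ?_⟩
  rintro v ⟨hv, hvmin⟩
  have lift : ∀ y : Lp ℝ (ENNReal.ofReal p) (volume.restrict (prefractalDomain n)),
      (∀ z ∈ admissible s p n (φ₁ n) (φ₂ n),
        energy s p n (δ n) f b y ≤ energy s p n (δ n) f b z) →
      ∀ z ∈ obstacleSet s p (prefractalDomain n) (φ₁ n) (φ₂ n),
        obstacleEnergy s p (prefractalDomain n)
          ((Measure.hausdorffMeasure 1).restrict (frontier (prefractalDomain n)))
          (fun x => δ n * b x) f y ≤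
        obstacleEnergy s p (prefractalDomain n)
          ((Measure.hausdorffMeasure 1).restrict (frontier (prefractalDomain n)))
          (fun x => δ n * b x) f z := by
    intro y hy z hz
    obtain ⟨z', hz', hz'K⟩ := toLp z hz
    rw [← obstacleEnergy_congr hz', ← energy_eq_obstacleEnergy, ← energy_eq_obstacleEnergy]
    exact hy z' hz'K
  exact Lp.ext (hw.ae_eq_of_minimizers hG hp hsp hfn ((mem_admissible_iff hp1).1 hv)
    ((mem_admissible_iff hp1).1 hu) (lift v hvmin) (lift u humin))
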